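/- Let $m\in\mathbb{N}$, $m\ge 1$, let $m-1<\alpha<m$, and let $\phi:\mathbb{R}\to\mathbb{R}$ be even and of class $C^m$. Suppose that for some $s\in\mathbb{C}$ with $\Re(s)>0$ (in particular for some $s$ with $0<\Re(s)<1$) and for every $j=0,\dots,m-1$ $$\lim_{r\to 0^+}\phi^{(j)}(r)\,r^{s-\alpha+j}=0,\qquad \lim_{r\to+\infty}\phi^{(j)}(r)\,r^{s-\alpha+j}=0 .$$ Let $$\mathbb{D}^\alpha_\xi\phi(\xi)=\frac{1}{\Gamma(m-\alpha)}\int_0^\xi(\xi-\tau)^{m-\alpha-1}\phi^{(m)}(\tau)\,d\tau\qquad(\xi>0)$$ be the Caputo derivative, and let $\mathcal{D}^\alpha_x=-(-d^2/dx^2)^{\alpha/2}$ be the Riesz derivative: for $0<\alpha<2$, $$\mathcal{D}_x^\alpha f(x)=\frac{\Gamma(1+\alpha)}{\pi}\sin\frac{\pi\alpha}{2}\int_0^\infty\frac{f(x+z)-2f(x)+f(x-z)}{z^{1+\alpha}}\,dz ,$$ and for $\alpha>2$, $\mathcal{D}_x^\alpha f=(-1)^k\mathcal{D}_x^{\alpha-2k}f^{(2k)}$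 with $k=\lfloor\alpha/2\rfloor$. Then the integral defining $\mathbb{D}^\alpha_\xi\phi(\xi)$ converges absolutely for every $\xi>0$, and for every $x\neq 0$ the integral defining $\mathcal{D}_x^\alpha\phi(x)$ converges absolutely and $$\mathcal{D}_x^\alpha\phi(|x|)=\int_0^\infty\{\mathbb{D}_\xi^\alpha\phi(\xi)\}\,\mathcal{E}(|x|/\xi)\,\frac{d\xi}{\xi},\qquad \mathcal{E}(\xi)=\frac{2}{\pi}\,\frac{\sin(\pi\alpha/2)}{1-\xi^2}-\cos\Big(\frac{\pi\alpha}{2}\Big)\,\xi\,\delta(\xi-1).$$ Here $1/(1-\xi^2)$ is a principal value at $\xi=1$, and the integral is improper at $\xi=\infty$. That is, the first term contributes the limit, as $\varepsilon\to0^+$ and $R\to\infty$, of $\frac{2}{\pi}\sin\frac{\pi\alpha}{2}\int \frac{\mathbb{D}_\xi^\alpha\phi(\xi)}{1-x^2/\xi^2}\frac{d\xi}{\xi}$ over $\{0<\xi<R,\ |\,|x|/\xi-1|>\varepsilon\}$ (these integrals converge absolutely and the limit exists), and the delta term contributes $-\cos(\pi\alpha/2)\,\mathbb{D}^\alpha_{\xi}\phi(\xi)|_{\xi=|x|}$.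 -/

import Mathlib

open Set Filter Topology MeasureTheory

noncomputable section

/-- The Riemann-Liouville fractional integral of order `β > 0`,
`(J^β f)(t) = Γ(β)⁻¹ ∫_0^t (t - τ)^(β - 1) f(τ) dτ`. -/
def rlIntegral (β : ℝ) (f : ℝ → ℝ) (t : ℝ) : ℝ :=
  1 / Real.Gamma β * ∫ τ in (0 : ℝ)..t, (t - τ) ^ (β - 1) * f τ

/-- The Caputo fractional derivative `J^(m - α) f^(m)` of order `m - 1 < α < m` on `(0, ∞)`. -/
def caputoDeriv (m : ℕ) (α : ℝ) (f : ℝ → ℝ) (t : ℝ) : ℝ :=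
  rlIntegral ((m : ℝ) - α) (iteratedDeriv m f) t

/-- The integrand of the regularised integral form of the Riesz fractional derivative. -/
def rieszIntegrand (β : ℝ) (f : ℝ → ℝ) (x z : ℝ) : ℝ :=
  (f (x + z) - 2 * f x + f (x - z)) / z ^ (1 + β)

/-- The Riesz fractional derivative of order `β ∈ (0, 2)`, whose Fourier symbol is `-|κ|^β`. -/
def rieszDerivBase (β : ℝ) (f : ℝ → ℝ) (x : ℝ) : ℝ :=
  Real.Gamma (1 + β) / Real.pi * Real.sin (Real.pi * β / 2) *
    ∫ z in Ioi (0 : ℝ), rieszIntegrand β f x z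

/-- The Riesz fractional derivative `-(-d²/dx²)^(α/2)` of order `α > 0` (not an even integer):
with `k = ⌊α/2⌋` it is `-(-d²/dx²)^((α - 2k)/2)` applied to `(-d²/dx²)^k f = (-1)^k f^(2k)`.
For `0 < α < 2` one has `k = 0` and this is the regularised integral above. -/
def rieszDeriv (α : ℝ) (f : ℝ → ℝ) (x : ℝ) : ℝ :=
  (-1) ^ ⌊α / 2⌋₊ *
    rieszDerivBase (α - 2 * (⌊α / 2⌋₊ : ℝ)) (iteratedDeriv (2 * ⌊α / 2⌋₊) f) x

/-- Absolute convergence of the integral that defines `rieszDeriv α f x`. -/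
def RieszConverges (α : ℝ) (f : ℝ → ℝ) (x : ℝ) : Prop :=
  IntegrableOn
    (rieszIntegrand (α - 2 * (⌊α / 2⌋₊ : ℝ)) (iteratedDeriv (2 * ⌊α / 2⌋₊) f) x) (Ioi 0)

/-- The function part `(2/π) sin(πα/2) / (1 - ξ²)` of the kernel `𝓔`,
to be integrated as a principal value at `ξ = 1`. -/
def kernelFun (α ξ : ℝ) : ℝ :=
  2 / Real.pi * (Real.sin (Real.pi * α / 2) / (1 - ξ ^ 2))

/-- The factor `-cos(πα/2) ξ` of `δ(ξ - 1)` in the kernel `𝓔`. -/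
def kernelDeltaFactor (α ξ : ℝ) : ℝ :=
  -(Real.cos (Real.pi * α / 2) * ξ)

/-- The part of `(0, R)` on which the argument `r/ξ` of the kernel stays `ε`-away from `1`. -/
def truncDomain (r ε R : ℝ) : Set ℝ :=
  {ξ | 0 < ξ ∧ ξ < R ∧ ε < |r / ξ - 1|}

/-- `HasKernelConvolution α g r I` says that, for `r > 0`, the Mellin convolution
`∫_0^∞ g(ξ) 𝓔(r/ξ) dξ/ξ` with the kernel
`𝓔(ξ) = (2/π) sin(πα/2) / (1 - ξ²) - cos(πα/2) ξ δ(ξ - 1)` exists and equals `I`.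
The function part is a principal value at `ξ = r` and an improper integral at `ξ = ∞`.
The delta part is written in the variable `u = r/ξ`, `dξ/ξ = du/u`, as the integral
`∫ g(r/u) (-cos(πα/2) u) δ(u - 1) du/u` against the Dirac measure at `1`. -/
def HasKernelConvolution (α : ℝ) (g : ℝ → ℝ) (r I : ℝ) : Prop :=
  (∀ ε > 0, ∀ R > 0,
    IntegrableOn (fun ξ => g ξ * kernelFun α (r / ξ) / ξ) (truncDomain r ε R)) ∧
  ∃ P : ℝ,
    Tendsto (fun p : ℝ × ℝ => ∫ ξ in truncDomain r p.1 p.2, g ξ * kernelFun α (r / ξ) / ξ)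
      (𝓝[>] (0 : ℝ) ×ˢ atTop) (𝓝 P) ∧
    I = P + ∫ u, g (r / u) * kernelDeltaFactor α u / u ∂(Measure.dirac (1 : ℝ))

end

/-! Put n = m - 1, γ = α - n ∈ (0, 1), ψ = φ^(m), H = φ^(m-1), r = |x|. The Caputo derivative is
Γ(1-γ)⁻¹ ∫_0^ξ ψ(y) (ξ-y)^(-γ) dy, and by partial fractions the function part of the kernel is
sin(πα/2)/π · (1/(ξ-r) + 1/(ξ+r)). Exchanging integrals leaves transforms of one truncated power: PV
∫ v₊^(-γ)/(v-1) dv = π cot(πγ) for y < r at the pole r, and ∫ v₊^(-γ)/(v+1) dv = π/sin(πγ) for y > r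
or at the pole -r.

With J = ∫_0^r ψ(y) (r-y)^(-γ) dy, the outcome is π cot(πγ) J plus π/sin(πγ) times the improper
integrals of ψ(y) (y-r)^(-γ) over (r, ∞) and of ψ(y) (y+r)^(-γ) over (0, ∞). Parity of ψ moves the
latter to the left of r at the cost of another multiple of J, and integration by parts produces γ ∫
(H(r±z) - H(r)) z^(-1-γ) dz. In `hasKernelConvolution_rlIntegral` the delta term and
`sin_half_combination` cancel every J. For n even the sum of the two increment integrals is the
Riesz integral of H (`riesz_increment_sum`); for n odd their difference comes from the second
difference of φ^(n-1) by one more integration by parts (`riesz_increment_sub`).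

Two points need care. At ξ = r, subtracting from v₊^(-γ) the indicator of (0, 2), symmetric about 1,
makes the Hilbert kernel integrable; after superposition the subtracted part is odd about r with
bounded numerator, so it vanishes in the principal value. At infinity, ψ is cut off to (0, R], so
that Fubini applies over the whole line; the range ξ > R contributes O(R^(q-γ)), where |H(y)| ≤ C
(1+|y|)^q with q < γ. That growth bound follows from the limits at +∞ and Re s > 0
(`exists_growth_bound`). -/

/-! ### Stieltjes and Hilbert transforms of a truncated power. -/

/-- The truncated power `u₊^(-γ)`. -/
noncomputable def truncPow (γ u : ℝ) : ℝ := if 0 < u then u ^ (-γ) else 0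

/-- The Stieltjes kernel `v₊^(-γ) / (v + 1)`. -/
noncomputable def stieltjesKernel (γ v : ℝ) : ℝ := truncPow γ v / (v + 1)

/-- The regularised Hilbert kernel `(v₊^(-γ) - 1_{(0,2)}(v)) / (v - 1)`. -/
noncomputable def hilbertKernel (γ v : ℝ) : ℝ :=
  (truncPow γ v - if 0 < v ∧ v < 2 then 1 else 0) / (v - 1)

lemma truncPow_of_pos {γ u : ℝ} (hu : 0 < u) : truncPow γ u = u ^ (-γ) := if_pos hu

lemma truncPow_of_nonpos {γ u : ℝ} (hu : u ≤ 0) : truncPow γ u = 0 := if_neg hu.not_gt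

lemma truncPow_nonneg (γ u : ℝ) : 0 ≤ truncPow γ u := by
  unfold truncPow
  split_ifs with h
  · exact Real.rpow_nonneg h.le _
  · exact le_rfl

lemma measurable_truncPow (γ : ℝ) : Measurable (truncPow γ) :=
  Measurable.ite measurableSet_Ioi (by fun_prop) measurable_const

lemma measurable_stieltjesKernel (γ : ℝ) : Measurable (stieltjesKernel γ) :=
  (measurable_truncPow γ).div (by fun_prop)

lemma measurable_hilbertKernel (γ : ℝ) : Measurable (hilbertKernel γ) :=
  ((measurable_truncPow γ).sub
    (Measurable.ite measurableSet_Ioo measurable_const measurable_const)).div (by fun_prop)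

lemma truncPow_mul {γ a : ℝ} (ha : 0 < a) (v : ℝ) :
    truncPow γ (a * v) = a ^ (-γ) * truncPow γ v := by
  unfold truncPow
  by_cases hv : 0 < v
  · rw [if_pos hv, if_pos (by positivity), Real.mul_rpow ha.le hv.le]
  · rw [if_neg hv, if_neg (by simpa [ha] using hv), mul_zero]

/-- The substitution t = v/(v+1) turns the integral into the Beta integral B(1-γ, γ), and Euler's
reflection formula evaluates it. -/
lemma integrable_stieltjesKernel_and_integral {γ : ℝ} (h0 : 0 < γ) (h1 : γ < 1) :
    Integrable (stieltjesKernel γ) ∧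
      ∫ v, stieltjesKernel γ v = Real.pi / Real.sin (Real.pi * γ) := by
  have hind : (Ioi (0 : ℝ)).indicator (fun v : ℝ => v ^ (-γ) / (v + 1)) = stieltjesKernel γ := by
    ext v
    by_cases hv : 0 < v
    · simp [indicator, hv, stieltjesKernel, truncPow]
    · simp [indicator, hv, stieltjesKernel, truncPow]
  set b : ℝ → ℂ := fun x => (x : ℂ) ^ ((1 - γ : ℝ) - 1 : ℂ) * (1 - (x : ℂ)) ^ ((γ : ℂ) - 1)
  have himg : (fun v : ℝ => v / (v + 1)) '' Ioi 0 = Ioo 0 1 := by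
    ext y
    constructor
    · rintro ⟨v, hv, rfl⟩
      have hv : (0 : ℝ) < v := hv
      exact ⟨by positivity, by rw [div_lt_one (by positivity)]; linarith⟩
    · rintro ⟨hy0, hy1⟩
      have : 0 < 1 - y := by linarith
      refine ⟨y / (1 - y), div_pos hy0 this, ?_⟩
      field_simp
      ring
  have hder : ∀ v ∈ Ioi (0 : ℝ),
      HasDerivWithinAt (fun v : ℝ => v / (v + 1)) (1 / (v + 1) ^ 2) (Ioi 0) v := by
    intro v hv
    have hv : (0 : ℝ) < v := hv
    have := ((hasDerivAt_id v).div ((hasDerivAt_id v).add_const 1) (by simp; positivity))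
    convert! this.hasDerivWithinAt using 1
    simp
  have hinj : InjOn (fun v : ℝ => v / (v + 1)) (Ioi 0) := by
    intro v hv w hw h
    have hv : (0 : ℝ) < v := hv
    have hw : (0 : ℝ) < w := hw
    simp only at h
    rw [div_eq_div_iff (by positivity) (by positivity)] at h
    linarith
  have hpt : ∀ v ∈ Ioi (0 : ℝ), |1 / (v + 1) ^ 2| • b (v / (v + 1))
      = ((v ^ (-γ) / (v + 1) : ℝ) : ℂ) := by
    intro v hv
    have hv : (0 : ℝ) < v := hv
    have hv1 : (0 : ℝ) < v + 1 := by positivity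
    have e1 : (1 : ℝ) - v / (v + 1) = 1 / (v + 1) := by field_simp; ring
    have e2 : b (v / (v + 1))
        = (((v / (v + 1)) ^ (-γ) * (1 / (v + 1)) ^ (γ - 1) : ℝ) : ℂ) := by
      simp only [b]
      rw [show ((1 - γ : ℝ) - 1 : ℂ) = ((-γ : ℝ) : ℂ) by push_cast; ring,
        show ((γ : ℂ) - 1) = ((γ - 1 : ℝ) : ℂ) by push_cast; ring,
        show (1 : ℂ) - ((v / (v + 1) : ℝ) : ℂ) = ((1 / (v + 1) : ℝ) : ℂ) by
          rw [← e1]; push_cast; ring,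
        ← Complex.ofReal_cpow (by positivity), ← Complex.ofReal_cpow (by positivity)]
      push_cast; ring
    rw [e2, Complex.real_smul, ← Complex.ofReal_mul, abs_of_pos (by positivity)]
    congr 1
    rw [Real.div_rpow hv.le hv1.le, Real.div_rpow zero_le_one hv1.le, Real.one_rpow,
      Real.rpow_sub hv1, Real.rpow_neg hv1.le, Real.rpow_one]
    have := (Real.rpow_pos_of_pos hv1 γ).ne'
    field_simp
  have hconv := Complex.betaIntegral_convergent (u := ((1 - γ : ℝ) : ℂ)) (v := (γ : ℂ))
    (by simpa using h1) (by simpa using h0)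
  have hbint : IntegrableOn b (Ioo 0 1) := by
    rw [intervalIntegrable_iff_integrableOn_Ioo_of_le zero_le_one] at hconv
    exact hconv
  have hint : IntegrableOn (fun v : ℝ => ((v ^ (-γ) / (v + 1) : ℝ) : ℂ)) (Ioi 0) := by
    rw [← himg, integrableOn_image_iff_integrableOn_abs_deriv_smul measurableSet_Ioi hder hinj]
      at hbint
    exact (integrableOn_congr_fun hpt measurableSet_Ioi).1 hbint
  have hintR : IntegrableOn (fun v : ℝ => v ^ (-γ) / (v + 1)) (Ioi 0) := by
    exact (Integrable.re hint :)
  have hval : ∫ v in Ioi (0 : ℝ), v ^ (-γ) / (v + 1) = Real.pi / Real.sin (Real.pi * γ) := by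
    have h2 := integral_image_eq_integral_abs_deriv_smul measurableSet_Ioi hder hinj b
    rw [himg, setIntegral_congr_fun measurableSet_Ioi hpt, integral_complex_ofReal] at h2
    have h3 : ∫ x in Ioo 0 1, b x = Complex.betaIntegral ((1 - γ : ℝ) : ℂ) (γ : ℂ) := by
      rw [Complex.betaIntegral, intervalIntegral.integral_of_le zero_le_one,
        integral_Ioc_eq_integral_Ioo]
    rw [h3, Complex.betaIntegral_eq_Gamma_mul_div _ _ (by simpa using h1) (by simpa using h0)]
      at h2
    rw [show ((1 - γ : ℝ) : ℂ) + (γ : ℂ) = 1 by push_cast; ring, Complex.Gamma_one, div_one,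
      Complex.Gamma_ofReal, Complex.Gamma_ofReal, ← Complex.ofReal_mul] at h2
    rw [← Complex.ofReal_inj.1 h2, mul_comm, Real.Gamma_mul_Gamma_one_sub]
  rw [← hind]
  exact ⟨(integrable_indicator_iff measurableSet_Ioi).2 hintR,
    by rw [integral_indicator measurableSet_Ioi, hval]⟩

/-- Dominated by v^(-γ) on (0, 1], by 1 on (1, 2), and by 2 v^(-γ-1) on [2, ∞), where v - 1 ≥ v/2.
-/
lemma integrable_hilbertKernel {γ : ℝ} (h0 : 0 < γ) (h1 : γ < 1) :
    Integrable (hilbertKernel γ) := by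
  have hm := (measurable_hilbertKernel γ).aestronglyMeasurable (μ := volume)
  have hcover : (univ : Set ℝ) = Iic 0 ∪ (Ioc 0 1 ∪ (Ioo 1 2 ∪ Ici 2)) := by
    ext v; simp only [mem_univ, mem_union, mem_Iic, mem_Ioc, mem_Ioo, mem_Ici, true_iff]; grind
  rw [← integrableOn_univ, hcover]
  refine IntegrableOn.union ?_ (IntegrableOn.union ?_ (IntegrableOn.union ?_ ?_))
  · refine (integrableOn_congr_fun (f := fun _ => (0 : ℝ)) ?_ measurableSet_Iic).1
      integrableOn_zero
    intro v hv
    have hv : v ≤ 0 := hv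
    simp [hilbertKernel, truncPow_of_nonpos hv, hv.not_gt]
  · have hi : IntegrableOn (fun v : ℝ => v ^ (-γ)) (Ioc 0 1) := by
      have := intervalIntegral.intervalIntegrable_rpow' (a := 0) (b := 1) (r := -γ) (by linarith)
      rwa [intervalIntegrable_iff_integrableOn_Ioc_of_le zero_le_one] at this
    refine Integrable.mono' hi hm.restrict ?_
    refine (ae_restrict_iff' measurableSet_Ioc).2 (Eventually.of_forall fun v hv => ?_)
    rcases eq_or_lt_of_le hv.2 with rfl | hv1
    · simp [hilbertKernel]
    have hv0 := hv.1
    have hp := Real.rpow_pos_of_pos hv0 γ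
    have hle : v ≤ v ^ γ := by
      simpa using Real.rpow_le_rpow_of_exponent_ge hv0 hv1.le h1.le
    have hle1 : v ^ γ ≤ 1 := Real.rpow_le_one hv0.le hv1.le h0.le
    rw [hilbertKernel, truncPow_of_pos hv0, if_pos ⟨hv0, by linarith⟩, Real.norm_eq_abs, abs_div,
      abs_of_neg (by linarith : v - 1 < 0), div_le_iff₀ (by linarith), Real.rpow_neg hv0.le,
      abs_of_nonneg (by rw [sub_nonneg]; exact (one_le_inv₀ hp).2 hle1)]
    field_simp
    linarith
  · refine Measure.integrableOn_of_bounded (M := 1) (by simp) hm ?_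
    refine (ae_restrict_iff' measurableSet_Ioo).2 (Eventually.of_forall fun v hv => ?_)
    have hv0 : 0 < v := by linarith [hv.1]
    have hp := Real.rpow_pos_of_pos hv0 γ
    have hle : v ^ γ ≤ v := by
      simpa using Real.rpow_le_rpow_of_exponent_le hv.1.le h1.le
    have hle1 : 1 ≤ v ^ γ := Real.one_le_rpow hv.1.le h0.le
    rw [hilbertKernel, truncPow_of_pos hv0, if_pos ⟨hv0, hv.2⟩, Real.norm_eq_abs, abs_div,
      abs_of_pos (by linarith [hv.1] : 0 < v - 1), div_le_iff₀ (by linarith [hv.1]),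
      Real.rpow_neg hv0.le, abs_of_nonpos (by rw [sub_nonpos]; exact inv_le_one_of_one_le₀ hle1)]
    have : (v ^ γ)⁻¹ ≥ 0 := by positivity
    nlinarith [mul_inv_cancel₀ hp.ne']
  · have hi : IntegrableOn (fun v : ℝ => 2 * v ^ (-γ - 1)) (Ici 2) := by
      rw [integrableOn_Ici_iff_integrableOn_Ioi]
      exact (integrableOn_Ioi_rpow_of_lt (by linarith) (by norm_num)).const_mul 2
    refine Integrable.mono' hi hm.restrict ?_
    refine (ae_restrict_iff' measurableSet_Ici).2 (Eventually.of_forall fun v hv => ?_)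
    have hv : 2 ≤ v := hv
    have hv0 : 0 < v := by linarith
    have hp := Real.rpow_pos_of_pos hv0 (-γ)
    rw [hilbertKernel, truncPow_of_pos hv0, if_neg (by simp [hv]), sub_zero, Real.norm_eq_abs,
      abs_of_nonneg (div_nonneg hp.le (by linarith)), div_le_iff₀ (by linarith),
      Real.rpow_sub hv0, Real.rpow_one]
    rw [show 2 * (v ^ (-γ) / v) * (v - 1) = v ^ (-γ) * ((2 * v - 2) / v) by ring]
    exact le_mul_of_one_le_right hp.le (by rw [one_le_div hv0]; linarith)

/-- This is the Mittag-Leffler expansion of π cot(πγ) with the terms paired differently: the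
positive terms are shifted by one index, so partial sums differ by 1/γ - 1/(n+γ). -/
lemma hasSum_cot_pi_mul {γ : ℝ} (h0 : 0 < γ) (h1 : γ < 1)
    (hs : Summable fun n : ℕ => 1 / (n + γ) - 1 / (n + 1 - γ)) :
    HasSum (fun n : ℕ => 1 / (n + γ) - 1 / (n + 1 - γ))
      (Real.pi * Real.cos (Real.pi * γ) / Real.sin (Real.pi * γ)) := by
  have hz : (γ : ℂ) ∈ Complex.integerComplement := by
    rintro ⟨n, hn⟩
    have hn : (n : ℝ) = γ := by exact_mod_cast hn
    rw [← hn] at h0 h1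
    have h0 : 0 < n := by exact_mod_cast h0
    have h1 : n < 1 := by exact_mod_cast h1
    lia
  have hc : HasSum (fun n : ℕ => 1 / (γ - (n + 1)) + 1 / (γ + (n + 1)))
      (Real.pi * Real.cos (Real.pi * γ) / Real.sin (Real.pi * γ) - 1 / γ) := by
    have h := (summable_cotTerm hz).hasSum
    rw [← cot_series_rep' hz] at h
    rw [← Complex.hasSum_ofReal]
    convert! h using 1
    · ext n; simp [cotTerm]
    · rw [Complex.cot]; push_cast; ring
  have hlim := hc.tendsto_sum_nat
  have hinv : Tendsto (fun n : ℕ => 1 / ((n : ℝ) + γ)) atTop (𝓝 0) := by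
    simp only [one_div]
    exact tendsto_inv_atTop_zero.comp
      (tendsto_atTop_add_const_right _ _ tendsto_natCast_atTop_atTop)
  have hpart : ∀ n : ℕ, ∑ i ∈ Finset.range n, (1 / ((i : ℝ) + γ) - 1 / (i + 1 - γ))
      = (∑ i ∈ Finset.range n, (1 / (γ - (i + 1)) + 1 / (γ + (i + 1)))) + 1 / γ
        - 1 / (n + γ) := by
    intro n
    induction n with
    | zero => simp
    | succ k ih =>
      rw [Finset.sum_range_succ, Finset.sum_range_succ, ih]
      have : 1 / (γ - ((k : ℝ) + 1)) = -(1 / ((k : ℝ) + 1 - γ)) := by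
        rw [← neg_sub, div_neg]
      rw [this]; push_cast
      ring
  rw [hs.hasSum_iff_tendsto_nat]
  simp_rw [hpart]
  simpa using (hlim.add_const (1 / γ)).sub hinv

/-- Expand 1/(1-t) as a geometric series and integrate termwise to reach the cotangent series. -/
lemma integral_rpow_sub_div_one_sub {γ : ℝ} (h0 : 0 < γ) (h1 : γ < 1) :
    ∫ t in Ioo (0 : ℝ) 1, (t ^ (γ - 1) - t ^ (-γ)) / (1 - t)
      = Real.pi * Real.cos (Real.pi * γ) / Real.sin (Real.pi * γ) := by
  set F : ℕ → ℝ → ℝ := fun n t => t ^ (n + γ - 1) - t ^ (n - γ) with hF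
  have hi1 : ∀ n : ℕ, IntegrableOn (fun t : ℝ => t ^ ((n : ℝ) + γ - 1)) (Ioo 0 1) := by
    intro n
    have := intervalIntegral.intervalIntegrable_rpow' (a := 0) (b := 1) (r := (n : ℝ) + γ - 1)
      (by have : (0 : ℝ) ≤ n := by positivity
          linarith)
    rwa [intervalIntegrable_iff_integrableOn_Ioo_of_le zero_le_one] at this
  have hi2 : ∀ n : ℕ, IntegrableOn (fun t : ℝ => t ^ ((n : ℝ) - γ)) (Ioo 0 1) := by
    intro n
    have := intervalIntegral.intervalIntegrable_rpow' (a := 0) (b := 1) (r := (n : ℝ) - γ)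
      (by have : (0 : ℝ) ≤ n := by positivity
          linarith)
    rwa [intervalIntegrable_iff_integrableOn_Ioo_of_le zero_le_one] at this
  have hFi : ∀ n, IntegrableOn (F n) (Ioo 0 1) := fun n => (hi1 n).sub (hi2 n)
  have hFv : ∀ n : ℕ, ∫ t in Ioo (0 : ℝ) 1, F n t = 1 / (n + γ) - 1 / (n + 1 - γ) := by
    intro n
    have hn : (0 : ℝ) ≤ n := by positivity
    rw [integral_sub (hi1 n) (hi2 n), ← integral_Ioc_eq_integral_Ioo,
      ← integral_Ioc_eq_integral_Ioo, ← intervalIntegral.integral_of_le zero_le_one,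
      ← intervalIntegral.integral_of_le zero_le_one, integral_rpow (Or.inl (by linarith)),
      integral_rpow (Or.inl (by linarith)), Real.one_rpow, Real.one_rpow,
      Real.zero_rpow (by linarith), Real.zero_rpow (by linarith)]
    congr 2 <;> ring
  have hFn : ∀ n : ℕ, ∫ t in Ioo (0 : ℝ) 1, ‖F n t‖ = |1 / (n + γ) - 1 / (n + 1 - γ)| := by
    intro n
    rw [← hFv]
    -- The sign of `F n t` depends only on whether γ is below or above 1/2, so the integral of the
    -- norm is the modulus of the integral.
    rcases le_total γ (1 / 2) with hγ | hγ
    · have hpos : ∀ t ∈ Ioo (0 : ℝ) 1, 0 ≤ F n t := fun t ht =>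
        sub_nonneg.2 (Real.rpow_le_rpow_of_exponent_ge ht.1 ht.2.le (by linarith))
      rw [abs_of_nonneg (setIntegral_nonneg measurableSet_Ioo hpos)]
      exact setIntegral_congr_fun measurableSet_Ioo fun t ht => Real.norm_of_nonneg (hpos t ht)
    · have hneg : ∀ t ∈ Ioo (0 : ℝ) 1, F n t ≤ 0 := fun t ht =>
        sub_nonpos.2 (Real.rpow_le_rpow_of_exponent_ge ht.1 ht.2.le (by linarith))
      rw [abs_of_nonpos (setIntegral_nonpos measurableSet_Ioo hneg), ← integral_neg]
      exact setIntegral_congr_fun measurableSet_Ioo fun t ht => Real.norm_of_nonpos (hneg t ht)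
  have hsum : Summable fun n : ℕ => |1 / ((n : ℝ) + γ) - 1 / (n + 1 - γ)| := by
    rw [← summable_nat_add_iff 1]
    have h2 : Summable fun n : ℕ => 1 / ((n + 1 : ℕ) : ℝ) ^ 2 :=
      (summable_nat_add_iff 1).2 (Real.summable_one_div_nat_pow.2 one_lt_two)
    refine Summable.of_nonneg_of_le (fun _ => abs_nonneg _) (fun n => ?_) h2
    have hn : (0 : ℝ) < ((n + 1 : ℕ) : ℝ) := by positivity
    set x : ℝ := ((n + 1 : ℕ) : ℝ)
    rw [div_sub_div _ _ (by linarith) (by linarith), abs_div,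
      abs_of_pos (by nlinarith : 0 < (x + γ) * (x + 1 - γ))]
    -- The numerator is 1 - 2γ, of modulus at most 1, and the denominator is at least x².
    refine div_le_div₀ zero_le_one ?_ (by positivity) (by nlinarith)
    rw [abs_le]; constructor <;> linarith
  have hser := hasSum_integral_of_summable_integral_norm (μ := volume.restrict (Ioo 0 1))
    (F := F) hFi (by simpa only [hFn] using hsum)
  simp only [hFv] at hser
  have hts : ∀ t ∈ Ioo (0 : ℝ) 1, ∑' n, F n t = (t ^ (γ - 1) - t ^ (-γ)) / (1 - t) := by
    intro t ht
    have : ∀ n, F n t = t ^ n * (t ^ (γ - 1) - t ^ (-γ)) := by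
      intro n
      simp only [hF]
      rw [mul_sub, ← Real.rpow_natCast, ← Real.rpow_add ht.1, ← Real.rpow_add ht.1,
        add_sub_assoc, ← sub_eq_add_neg]
    simp_rw [this]
    rw [tsum_mul_right, tsum_geometric_of_lt_one ht.1.le ht.2, div_eq_inv_mul]
  rw [setIntegral_congr_fun measurableSet_Ioo hts] at hser
  exact hser.unique (hasSum_cot_pi_mul h0 h1 hsum.of_abs)

/-- Fold (1, ∞) onto (0, 1) by v = 1/t. The powers combine into the cotangent integrand, and the
folded indicator leaves a remainder of integral zero. -/
lemma integral_hilbertKernel {γ : ℝ} (h0 : 0 < γ) (h1 : γ < 1) :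
    ∫ v, hilbertKernel γ v = Real.pi * Real.cos (Real.pi * γ) / Real.sin (Real.pi * γ) := by
  have hi := integrable_hilbertKernel h0 h1
  set g : ℝ → ℝ := (Ioi 1).indicator (hilbertKernel γ) with hg
  have hgi : IntegrableOn g (Ioi 0) := (hi.indicator measurableSet_Ioi).integrableOn
  have hsplit : ∫ v, hilbertKernel γ v
      = (∫ v in Ioo 0 1, hilbertKernel γ v) + ∫ v in Ioi 0, g v := by
    have e1 : ∫ v, hilbertKernel γ v = ∫ v in Ioi 0, hilbertKernel γ v := by
      refine (setIntegral_eq_integral_of_forall_compl_eq_zero fun v hv => ?_).symm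
      have hv : v ≤ 0 := not_lt.1 hv
      simp [hilbertKernel, truncPow_of_nonpos hv, hv.not_gt]
    rw [e1, hg, setIntegral_indicator measurableSet_Ioi, Ioi_inter_Ioi,
      sup_of_le_right zero_le_one, ← Ioc_union_Ioi_eq_Ioi (zero_le_one' ℝ),
      setIntegral_union (Ioc_disjoint_Ioi le_rfl) measurableSet_Ioi hi.integrableOn
        hi.integrableOn, integral_Ioc_eq_integral_Ioo]
  have hsub : ∫ v in Ioi 0, g v = ∫ t in Ioo 0 1, t ^ (-2 : ℝ) * hilbertKernel γ t⁻¹ := by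
    rw [← integral_comp_rpow_Ioi g (p := -1) (by norm_num)]
    have : ∀ t ∈ Ioi (0 : ℝ), (|(-1 : ℝ)| * t ^ ((-1 : ℝ) - 1)) • g (t ^ (-1 : ℝ))
        = (Iio 1).indicator (fun t => t ^ (-2 : ℝ) * hilbertKernel γ t⁻¹) t := by
      intro t ht
      have ht : 0 < t := ht
      rw [Real.rpow_neg_one]
      by_cases h : t < 1
      · have h' : 1 < t⁻¹ := (one_lt_inv₀ ht).2 h
        simp [hg, h, h']; norm_num
      · have h' : ¬ 1 < t⁻¹ := by rwa [one_lt_inv₀ ht]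
        simp [hg, h, h']
    rw [setIntegral_congr_fun measurableSet_Ioi this, setIntegral_indicator measurableSet_Iio,
      Ioi_inter_Iio]
  have hsubi : IntegrableOn (fun t => t ^ (-2 : ℝ) * hilbertKernel γ t⁻¹) (Ioo 0 1) := by
    rw [← integrableOn_Ioi_comp_rpow_iff' g (p := -1) (by norm_num)] at hgi
    refine (integrableOn_congr_fun (fun t ht => ?_) measurableSet_Ioo).1
      (hgi.mono_set Ioo_subset_Ioi_self)
    have h' : 1 < t⁻¹ := (one_lt_inv₀ ht.1).2 ht.2
    simp [hg, Real.rpow_neg_one, h']; norm_num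
  -- The remainder of the indicator of (0, 2) after folding; its two pieces integrate to -log 2 and
  -- log 2.
  set q : ℝ → ℝ := fun t => if 1 / 2 < t then -t⁻¹ else (1 - t)⁻¹ with hq
  have hpt : ∀ t ∈ Ioo (0 : ℝ) 1, hilbertKernel γ t + t ^ (-2 : ℝ) * hilbertKernel γ t⁻¹
      = (t ^ (γ - 1) - t ^ (-γ)) / (1 - t) + q t := by
    rintro t ⟨ht0, ht1⟩
    have hne : 1 - t ≠ 0 := by linarith
    have hne' : t - 1 ≠ 0 := by linarith
    have e : t⁻¹ - 1 = (1 - t) / t := by field_simp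
    have e2 : t⁻¹ < 2 ↔ 1 / 2 < t := by rw [inv_lt_comm₀ ht0 two_pos]; norm_num
    rw [hilbertKernel, hilbertKernel, truncPow_of_pos ht0, truncPow_of_pos (inv_pos.2 ht0),
      if_pos ⟨ht0, by linarith⟩, hq, e, Real.inv_rpow ht0.le, Real.rpow_neg ht0.le γ, inv_inv,
      Real.rpow_sub ht0, Real.rpow_one, show (-2 : ℝ) = ((-2 : ℤ) : ℝ) by norm_num,
      Real.rpow_intCast]
    have hp := (Real.rpow_pos_of_pos ht0 γ).ne'
    simp only [inv_pos, ht0, e2, true_and]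
    rw [show (t ^ (-2 : ℤ)) = 1 / t ^ 2 by simp [zpow_neg],
      show t - 1 = -(1 - t) by ring]
    split_ifs <;> field_simp <;> ring
  have hq1 : ∀ t ∈ Ioc (0 : ℝ) (1 / 2), q t = (1 - t)⁻¹ := fun t ht => if_neg (by simpa using ht.2)
  have hq2 : ∀ t ∈ Ioc (1 / 2 : ℝ) 1, q t = -t⁻¹ := fun t ht => if_pos ht.1
  have hv1 : ∫ t in (0 : ℝ)..(1 / 2), (1 - t)⁻¹ = Real.log 2 := by
    rw [intervalIntegral.integral_comp_sub_left (fun t => t⁻¹) 1,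
      integral_inv_of_pos (by norm_num) (by norm_num)]
    norm_num
  have hv2 : ∫ t in (1 / 2 : ℝ)..1, -t⁻¹ = -Real.log 2 := by
    rw [intervalIntegral.integral_neg, integral_inv_of_pos (by norm_num) (by norm_num)]
    norm_num
  have hqi1 : IntegrableOn q (Ioc 0 (1 / 2)) := by
    refine (integrableOn_congr_fun hq1 measurableSet_Ioc).2 ?_
    refine (ContinuousOn.integrableOn_Icc (ContinuousOn.inv₀ (by fun_prop) fun t ht => ?_)).mono_set
      Ioc_subset_Icc_self
    linarith [ht.2]
  have hqi2 : IntegrableOn q (Ioc (1 / 2) 1) := by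
    refine (integrableOn_congr_fun hq2 measurableSet_Ioc).2 ?_
    refine (ContinuousOn.integrableOn_Icc
      (ContinuousOn.inv₀ (by fun_prop) fun t ht => ?_).neg).mono_set Ioc_subset_Icc_self
    linarith [ht.1]
  have hu : Ioc (0 : ℝ) (1 / 2) ∪ Ioc (1 / 2) 1 = Ioc 0 1 :=
    Ioc_union_Ioc_eq_Ioc (by norm_num) (by norm_num)
  have hqi : IntegrableOn q (Ioo 0 1) :=
    (hu ▸ hqi1.union hqi2 : IntegrableOn q (Ioc 0 1)).mono_set Ioo_subset_Ioc_self
  have hqv : ∫ t in Ioo 0 1, q t = 0 := by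
    rw [← integral_Ioc_eq_integral_Ioo, ← hu,
      setIntegral_union (Ioc_disjoint_Ioc_of_le le_rfl) measurableSet_Ioc hqi1 hqi2,
      setIntegral_congr_fun measurableSet_Ioc hq1, setIntegral_congr_fun measurableSet_Ioc hq2,
      ← intervalIntegral.integral_of_le (by norm_num),
      ← intervalIntegral.integral_of_le (by norm_num), hv1, hv2, add_neg_cancel]
  have hci : IntegrableOn (fun t : ℝ => (t ^ (γ - 1) - t ^ (-γ)) / (1 - t)) (Ioo 0 1) := by
    refine (integrableOn_congr_fun (fun t ht => ?_) measurableSet_Ioo).1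
      ((hi.integrableOn.add hsubi).sub hqi)
    simp only [Pi.add_apply, Pi.sub_apply]
    rw [hpt t ht, add_sub_cancel_right]
  rw [hsplit, hsub, ← integral_add hi.integrableOn hsubi,
    setIntegral_congr_fun measurableSet_Ioo hpt, integral_add hci hqi, hqv, add_zero,
    integral_rpow_sub_div_one_sub h0 h1]

/-! ### Superpositions of translated and dilated kernels, by Fubini. -/

section Scaling

variable {γ : ℝ} {B : ℝ → ℝ}

lemma integrable_scaled_kernel (hB : Integrable B) {a : ℝ} (ha : 0 < a) (y : ℝ) :
    Integrable fun ξ => a ^ (-γ - 1) * B ((ξ - y) / a) :=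
  ((hB.comp_div ha.ne').comp_sub_right y).const_mul _

lemma integral_scaled_kernel (B : ℝ → ℝ) {a : ℝ} (ha : 0 < a) (y : ℝ) :
    ∫ ξ, a ^ (-γ - 1) * B ((ξ - y) / a) = a ^ (-γ) * ∫ v, B v := by
  rw [integral_const_mul, integral_sub_right_eq_self (fun ξ => B (ξ / a)) y,
    Measure.integral_comp_div, abs_of_pos ha, smul_eq_mul, ← mul_assoc, Real.rpow_sub ha,
    Real.rpow_one, div_mul_cancel₀ _ ha.ne']

variable {μ : Measure ℝ} {a w : ℝ → ℝ}

/-- Scaling gives the inner L¹ norm as |w| a^(-γ) ‖B‖₁, so integrability of w a^(-γ) is what Tonelli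
needs. The scale a may depend on y because here it is the distance from y to a fixed pole. -/
lemma integrable_prod_scaled_kernel (hBm : Measurable B) (hB : Integrable B) (ha : Measurable a)
    (hw : AEStronglyMeasurable w μ) (hpos : ∀ᵐ y ∂μ, 0 < a y)
    (hint : Integrable (fun y => w y * a y ^ (-γ)) μ) :
    Integrable (fun p : ℝ × ℝ => w p.1 * (a p.1 ^ (-γ - 1) * B ((p.2 - p.1) / a p.1)))
      (μ.prod volume) := by
  have hm : AEStronglyMeasurable
      (fun p : ℝ × ℝ => w p.1 * (a p.1 ^ (-γ - 1) * B ((p.2 - p.1) / a p.1)))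
      (μ.prod volume) := by
    refine hw.comp_fst.mul (Measurable.aestronglyMeasurable ?_)
    refine ((ha.comp measurable_fst).pow_const _).mul (hBm.comp ?_)
    exact (measurable_snd.sub measurable_fst).div (ha.comp measurable_fst)
  refine (integrable_prod_iff hm).2 ⟨?_, ?_⟩
  · filter_upwards [hpos] with y hy
    exact (integrable_scaled_kernel hB hy y).const_mul _
  · refine (hint.norm.mul_const (∫ v, ‖B v‖)).congr ?_
    filter_upwards [hpos] with y hy
    have h1 := integral_scaled_kernel (γ := γ) (fun v => ‖B v‖) hy y
    have h2 : ∀ p : ℝ, 0 ≤ a y ^ p := fun p => Real.rpow_nonneg hy.le p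
    simp only [norm_mul, integral_const_mul, Real.norm_of_nonneg (h2 _)] at h1 ⊢
    rw [h1, mul_assoc]

lemma integrable_superposition_scaled_kernel [SFinite μ] (hBm : Measurable B) (hB : Integrable B)
    (ha : Measurable a) (hw : AEStronglyMeasurable w μ) (hpos : ∀ᵐ y ∂μ, 0 < a y)
    (hint : Integrable (fun y => w y * a y ^ (-γ)) μ) :
    Integrable fun ξ => ∫ y, w y * (a y ^ (-γ - 1) * B ((ξ - y) / a y)) ∂μ :=
  (integrable_prod_scaled_kernel hBm hB ha hw hpos hint).integral_prod_right

lemma integral_superposition_scaled_kernel [SFinite μ] (hBm : Measurable B) (hB : Integrable B)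
    (ha : Measurable a) (hw : AEStronglyMeasurable w μ) (hpos : ∀ᵐ y ∂μ, 0 < a y)
    (hint : Integrable (fun y => w y * a y ^ (-γ)) μ) :
    ∫ ξ, ∫ y, w y * (a y ^ (-γ - 1) * B ((ξ - y) / a y)) ∂μ
      = (∫ v, B v) * ∫ y, w y * a y ^ (-γ) ∂μ := by
  rw [← integral_integral_swap
    (f := fun y ξ => w y * (a y ^ (-γ - 1) * B ((ξ - y) / a y)))
    (integrable_prod_scaled_kernel hBm hB ha hw hpos hint), ← integral_const_mul]
  refine integral_congr_ae ?_
  filter_upwards [hpos] with y hy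
  rw [integral_const_mul, integral_scaled_kernel B hy]
  ring

end Scaling

/-! ### The cut-off convolution and its regular and singular parts. -/

lemma intervalIntegrable_truncPow {γ : ℝ} (h1 : γ < 1) (a b : ℝ) :
    IntervalIntegrable (truncPow γ) volume a b := by
  have h := intervalIntegral.intervalIntegrable_rpow' (a := a) (b := b) (r := -γ) (by linarith)
  have e : truncPow γ = (Ioi (0 : ℝ)).indicator (fun v => v ^ (-γ)) := by
    ext v; simp [truncPow, indicator]
  rw [intervalIntegrable_iff] at h ⊢
  rw [e]
  exact h.indicator measurableSet_Ioi

lemma integrableOn_mul_truncPow_sub {γ : ℝ} (h1 : γ < 1) {ψ : ℝ → ℝ} (hψ : Continuous ψ)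
    (a b ξ : ℝ) : IntegrableOn (fun y => ψ y * truncPow γ (ξ - y)) (Icc a b) := by
  rcases le_or_gt a b with hab | hab
  · have h := (intervalIntegrable_truncPow h1 (ξ - a) (ξ - b)).comp_sub_left ξ
    simp only [sub_sub_cancel] at h
    rw [intervalIntegrable_iff_integrableOn_Icc_of_le hab] at h
    exact h.continuousOn_mul hψ.continuousOn isCompact_Icc
  · simp [Icc_eq_empty hab.not_ge]

/-- The truncated-power convolution of `ψ` restricted to `(0, R]`. -/
noncomputable def truncConv (γ : ℝ) (ψ : ℝ → ℝ) (R ξ : ℝ) : ℝ :=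
  ∫ y in Ioc 0 R, ψ y * truncPow γ (ξ - y)

/-- The even factor of the odd singular part of `truncConv γ ψ R ξ / (ξ - r)`. -/
noncomputable def singularFactor (γ : ℝ) (ψ : ℝ → ℝ) (r t : ℝ) : ℝ :=
  ∫ y in Ioo 0 r, ψ y * if t < r - y then (r - y) ^ (-γ) else 0

/-- The part of `truncConv γ ψ R ξ / (ξ - r)` that is odd about `r` and not integrable there. -/
noncomputable def singularPart (γ : ℝ) (ψ : ℝ → ℝ) (r ξ : ℝ) : ℝ :=
  singularFactor γ ψ r |ξ - r| / (ξ - r)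

/-- The integrand of the transform of `truncConv γ ψ R` with its singular part removed. -/
noncomputable def regularPart (γ : ℝ) (ψ : ℝ → ℝ) (r R ξ : ℝ) : ℝ :=
  truncConv γ ψ R ξ * (1 / (ξ - r) + 1 / (ξ + r)) - singularPart γ ψ r ξ

lemma scaled_stieltjesKernel {γ a : ℝ} (ha : 0 < a) (y ξ : ℝ) :
    a ^ (-γ - 1) * stieltjesKernel γ ((ξ - y) / a) = truncPow γ (ξ - y) / (ξ - y + a) := by
  have h := truncPow_mul (γ := γ) ha ((ξ - y) / a)
  rw [mul_div_cancel₀ _ ha.ne'] at h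
  rw [stieltjesKernel, h, Real.rpow_sub ha, Real.rpow_one, div_add_one ha.ne']
  field_simp

/-- With a = r - y the denominator becomes ξ - r for every y, and the scaled indicator becomes |ξ -
r| < r - y, which is how `singularFactor` arises. -/
lemma scaled_hilbertKernel {γ a : ℝ} (ha : 0 < a) (y ξ : ℝ) :
    a ^ (-γ - 1) * hilbertKernel γ ((ξ - y) / a)
      = (truncPow γ (ξ - y) - if |ξ - y - a| < a then a ^ (-γ) else 0) / (ξ - y - a) := by
  have h := truncPow_mul (γ := γ) ha ((ξ - y) / a)
  rw [mul_div_cancel₀ _ ha.ne'] at h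
  have hiff : (0 < (ξ - y) / a ∧ (ξ - y) / a < 2) ↔ |ξ - y - a| < a := by
    rw [div_pos_iff_of_pos_right ha, div_lt_iff₀ ha, abs_lt]
    constructor <;> rintro ⟨h1, h2⟩ <;> constructor <;> linarith
  rw [hilbertKernel, h, Real.rpow_sub ha, Real.rpow_one, div_sub_one ha.ne']
  simp only [hiff]
  split_ifs
  · field_simp
  · field_simp; ring

section Regular

variable {γ r R : ℝ} {ψ : ℝ → ℝ}

lemma integrableOn_mul_rpow_sub (h1 : γ < 1) (hψ : Continuous ψ) (a : ℝ) :
    IntegrableOn (fun y => ψ y * (r - y) ^ (-γ)) (Ioo a r) := by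
  refine (integrableOn_congr_fun (fun y hy => ?_) measurableSet_Ioo).1
    ((integrableOn_mul_truncPow_sub h1 hψ a r r).mono_set Ioo_subset_Icc_self)
  rw [truncPow_of_pos (by linarith [hy.2])]

lemma integrableOn_mul_singular_indicator (h1 : γ < 1) (hψ : Continuous ψ) (t : ℝ) :
    IntegrableOn (fun y => ψ y * if t < r - y then (r - y) ^ (-γ) else 0) (Ioo 0 r) := by
  have h := (integrableOn_mul_rpow_sub (r := r) h1 hψ 0).indicator
    (measurableSet_Iio (a := r - t))
  refine h.congr (Eventually.of_forall fun y => ?_)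
  have : y < r - t ↔ t < r - y := by constructor <;> intro <;> linarith
  simp [indicator, this]

/-- The three scales r - y, y - r and y + r are the distances from y to the poles r (from either
side) and -r; each makes the kernel's denominator independent of y. -/
lemma regularPart_eq (h1 : γ < 1) (hψ : Continuous ψ) (hr : 0 < r) (hR : r < R) (ξ : ℝ) :
    regularPart γ ψ r R ξ
      = (∫ y in Ioo 0 r, ψ y * ((r - y) ^ (-γ - 1) * hilbertKernel γ ((ξ - y) / (r - y))))
        + (∫ y in Ioc r R, ψ y * ((y - r) ^ (-γ - 1) * stieltjesKernel γ ((ξ - y) / (y - r))))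
        + ∫ y in Ioc 0 R,
            ψ y * ((y + r) ^ (-γ - 1) * stieltjesKernel γ ((ξ - y) / (y + r))) := by
  have hi : IntegrableOn (fun y => ψ y * truncPow γ (ξ - y)) (Icc 0 R) :=
    integrableOn_mul_truncPow_sub h1 hψ 0 R ξ
  have e1 : ∫ y in Ioo 0 r, ψ y * ((r - y) ^ (-γ - 1) * hilbertKernel γ ((ξ - y) / (r - y)))
      = (∫ y in Ioo 0 r, ψ y * truncPow γ (ξ - y)) / (ξ - r) - singularPart γ ψ r ξ := by
    rw [singularPart, singularFactor, ← sub_div, ← integral_sub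
      (hi.mono_set (Ioo_subset_Icc_self.trans (Icc_subset_Icc_right hR.le)))
      (integrableOn_mul_singular_indicator h1 hψ _), ← integral_div]
    refine setIntegral_congr_fun measurableSet_Ioo fun y hy => ?_
    rw [scaled_hilbertKernel (by linarith [hy.2]), show ξ - y - (r - y) = ξ - r by ring]
    ring
  have e2 : ∫ y in Ioc r R, ψ y * ((y - r) ^ (-γ - 1) * stieltjesKernel γ ((ξ - y) / (y - r)))
      = (∫ y in Ioc r R, ψ y * truncPow γ (ξ - y)) / (ξ - r) := by
    rw [← integral_div]
    refine setIntegral_congr_fun measurableSet_Ioc fun y hy => ?_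
    rw [scaled_stieltjesKernel (by linarith [hy.1]), show ξ - y + (y - r) = ξ - r by ring]
    ring
  have e3 : ∫ y in Ioc 0 R, ψ y * ((y + r) ^ (-γ - 1) * stieltjesKernel γ ((ξ - y) / (y + r)))
      = truncConv γ ψ R ξ / (ξ + r) := by
    rw [truncConv, ← integral_div]
    refine setIntegral_congr_fun measurableSet_Ioc fun y hy => ?_
    rw [scaled_stieltjesKernel (by linarith [hy.1]), show ξ - y + (y + r) = ξ + r by ring]
    ring
  have e4 : truncConv γ ψ R ξ = (∫ y in Ioo 0 r, ψ y * truncPow γ (ξ - y))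
      + ∫ y in Ioc r R, ψ y * truncPow γ (ξ - y) := by
    rw [truncConv, ← Ioc_union_Ioc_eq_Ioc hr.le hR.le,
      setIntegral_union (Ioc_disjoint_Ioc_of_le le_rfl) measurableSet_Ioc
        (hi.mono_set (Ioc_subset_Icc_self.trans (Icc_subset_Icc_right hR.le)))
        (hi.mono_set (Ioc_subset_Icc_self.trans (Icc_subset_Icc_left hr.le))),
      integral_Ioc_eq_integral_Ioo]
  rw [e1, e2, e3, regularPart, mul_add, mul_one_div, mul_one_div]
  nth_rewrite 1 [e4]
  rw [add_div]
  ring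

/-- Integrability of the regular part, and its integral over the line. -/
lemma integrable_regularPart_and_integral (h0 : 0 < γ) (h1 : γ < 1) (hψ : Continuous ψ)
    (hr : 0 < r) (hR : r < R) :
    Integrable (regularPart γ ψ r R) ∧ ∫ ξ, regularPart γ ψ r R ξ
      = Real.pi * Real.cos (Real.pi * γ) / Real.sin (Real.pi * γ)
            * (∫ y in Ioo 0 r, ψ y * (r - y) ^ (-γ))
        + Real.pi / Real.sin (Real.pi * γ) * (∫ y in Ioc r R, ψ y * (y - r) ^ (-γ))
        + Real.pi / Real.sin (Real.pi * γ) * ∫ y in Ioc 0 R, ψ y * (y + r) ^ (-γ) := by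
  obtain ⟨hS, hSv⟩ := integrable_stieltjesKernel_and_integral h0 h1
  have hH := integrable_hilbertKernel h0 h1
  have hHm := measurable_hilbertKernel γ
  have hSm := measurable_stieltjesKernel γ
  have w1 : ∀ s : Set ℝ, AEStronglyMeasurable ψ (volume.restrict s) := fun s =>
    hψ.aestronglyMeasurable
  have p1 : ∀ᵐ y ∂volume.restrict (Ioo 0 r), 0 < r - y :=
    (ae_restrict_iff' measurableSet_Ioo).2 (Eventually.of_forall fun y hy => by linarith [hy.2])
  have p2 : ∀ᵐ y ∂volume.restrict (Ioc r R), 0 < y - r :=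
    (ae_restrict_iff' measurableSet_Ioc).2 (Eventually.of_forall fun y hy => by linarith [hy.1])
  have p3 : ∀ᵐ y ∂volume.restrict (Ioc 0 R), 0 < y + r :=
    (ae_restrict_iff' measurableSet_Ioc).2 (Eventually.of_forall fun y hy => by linarith [hy.1])
  have m1 : Measurable fun y : ℝ => r - y := by fun_prop
  have m2 : Measurable fun y : ℝ => y - r := by fun_prop
  have m3 : Measurable fun y : ℝ => y + r := by fun_prop
  have i1 := integrableOn_mul_rpow_sub (r := r) h1 hψ 0
  have i2 : IntegrableOn (fun y => ψ y * (y - r) ^ (-γ)) (Ioc r R) := by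
    have h := (intervalIntegrable_truncPow h1 0 (R - r)).comp_sub_right r
    simp only [zero_add, sub_add_cancel] at h
    rw [intervalIntegrable_iff_integrableOn_Icc_of_le hR.le] at h
    refine (integrableOn_congr_fun (fun y hy => ?_) measurableSet_Ioc).1
      ((h.continuousOn_mul hψ.continuousOn isCompact_Icc).mono_set Ioc_subset_Icc_self)
    rw [truncPow_of_pos (by linarith [hy.1])]
  have i3 : IntegrableOn (fun y => ψ y * (y + r) ^ (-γ)) (Ioc 0 R) := by
    refine (ContinuousOn.integrableOn_Icc (hψ.continuousOn.mul
      (ContinuousOn.rpow_const (by fun_prop) fun y hy => Or.inl ?_))).mono_set Ioc_subset_Icc_self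
    linarith [hy.1]
  have hfun : regularPart γ ψ r R = fun ξ => _ := funext (regularPart_eq h1 hψ hr hR)
  have I1 := integrable_superposition_scaled_kernel hHm hH m1 (w1 _) p1 i1
  have I2 := integrable_superposition_scaled_kernel hSm hS m2 (w1 _) p2 i2
  have I3 := integrable_superposition_scaled_kernel hSm hS m3 (w1 _) p3 i3
  rw [hfun]
  refine ⟨(I1.add I2).add I3, ?_⟩
  have A1 := integral_add (I1.add I2) I3
  have A2 := integral_add I1 I2
  simp only [Pi.add_apply] at A1 A2
  rw [A1, A2,
    integral_superposition_scaled_kernel hHm hH m1 (w1 _) p1 i1,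
    integral_superposition_scaled_kernel hSm hS m2 (w1 _) p2 i2,
    integral_superposition_scaled_kernel hSm hS m3 (w1 _) p3 i3, integral_hilbertKernel h0 h1, hSv]

end Regular

/-! ### The principal value: the singular part disappears in the limit. -/

section PrincipalValue

variable {γ r R ε : ℝ} {ψ : ℝ → ℝ}

lemma measurable_singularFactor (hψ : Continuous ψ) : Measurable (singularFactor γ ψ r) := by
  have h : Measurable fun p : ℝ × ℝ =>
      ψ p.2 * if p.1 < r - p.2 then (r - p.2) ^ (-γ) else 0 :=
    (hψ.measurable.comp measurable_snd).mul (Measurable.ite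
      (measurableSet_lt measurable_fst (measurable_const.sub measurable_snd))
      ((measurable_const.sub measurable_snd).pow_const _) measurable_const)
  exact (h.stronglyMeasurable.integral_prod_right' (ν := volume.restrict (Ioo 0 r))).measurable

lemma exists_abs_singularFactor_le (h1 : γ < 1) (hψ : Continuous ψ) :
    ∃ M, 0 ≤ M ∧ ∀ t, |singularFactor γ ψ r t| ≤ M := by
  have hi := (integrableOn_mul_rpow_sub (r := r) h1 hψ 0).norm
  refine ⟨∫ y in Ioo 0 r, ‖ψ y * (r - y) ^ (-γ)‖, by positivity, fun t => ?_⟩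
  rw [← Real.norm_eq_abs, singularFactor]
  refine norm_integral_le_of_norm_le hi (Eventually.of_forall fun y => ?_)
  split_ifs
  · exact le_rfl
  · rw [mul_zero, norm_zero]
    exact norm_nonneg _

lemma singularFactor_of_le {t : ℝ} (ht : r ≤ t) : singularFactor γ ψ r t = 0 := by
  refine setIntegral_eq_zero_of_forall_eq_zero fun y hy => ?_
  have : ¬ t < r - y := by linarith [hy.1]
  simp [this]

lemma measurable_singularPart (hψ : Continuous ψ) : Measurable (singularPart γ ψ r) :=
  ((measurable_singularFactor hψ).comp (by fun_prop)).div (by fun_prop)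

lemma singularPart_of_nonpos {ξ : ℝ} (hξ : ξ ≤ 0) : singularPart γ ψ r ξ = 0 := by
  rw [singularPart, singularFactor_of_le, zero_div]
  rw [abs_sub_comm]
  exact le_trans (by linarith) (le_abs_self _)

lemma singularPart_of_two_mul_le {ξ : ℝ} (hξ : 2 * r ≤ ξ) : singularPart γ ψ r ξ = 0 := by
  rw [singularPart, singularFactor_of_le, zero_div]
  exact le_trans (by linarith) (le_abs_self _)

lemma truncConv_of_nonpos {ξ : ℝ} (hξ : ξ ≤ 0) : truncConv γ ψ R ξ = 0 := by
  refine setIntegral_eq_zero_of_forall_eq_zero fun y hy => ?_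
  simp [truncPow_of_nonpos (γ := γ) (by linarith [hy.1] : ξ - y ≤ 0)]

lemma truncConv_eq_self {ξ : ℝ} (hξ : ξ ≤ R) : truncConv γ ψ R ξ = truncConv γ ψ ξ ξ := by
  refine setIntegral_eq_of_subset_of_forall_sdiff_eq_zero measurableSet_Ioc
    (Ioc_subset_Ioc_right hξ) fun y hy => ?_
  have : ξ < y := by
    by_contra h
    exact hy.2 ⟨hy.1.1, not_lt.1 h⟩
  rw [truncPow_of_nonpos (by linarith), mul_zero]

lemma regularPart_of_nonpos {ξ : ℝ} (hξ : ξ ≤ 0) : regularPart γ ψ r R ξ = 0 := by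
  rw [regularPart, truncConv_of_nonpos hξ, singularPart_of_nonpos hξ]
  simp

lemma measurableSet_truncDomain : MeasurableSet (truncDomain r ε R) :=
  measurableSet_Ioi.inter (measurableSet_Iio.inter
    (measurableSet_lt measurable_const
      (f := fun _ : ℝ => ε) (g := fun ξ : ℝ => |r / ξ - 1|) (by fun_prop)))

/-- The bound is the distance from r to the left edge r/(1+ε) of the excised interval, the nearer of
the two edges. -/
lemma abs_sub_ge_of_mem_truncDomain (hε : 0 < ε) {ξ : ℝ} (h : ξ ∈ truncDomain r ε R) :
    r * ε / (1 + ε) ≤ |ξ - r| := by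
  obtain ⟨h0, -, h2⟩ := h
  rw [div_sub_one h0.ne', abs_div, abs_of_pos h0, lt_div_iff₀ h0, abs_sub_comm] at h2
  rw [div_le_iff₀ (by linarith)]
  have : r - ξ ≤ |ξ - r| := by rw [abs_sub_comm]; exact le_abs_self _
  nlinarith

lemma integrableOn_singularPart_truncDomain (h1 : γ < 1) (hψ : Continuous ψ) (hr : 0 < r)
    (hε : 0 < ε) : IntegrableOn (singularPart γ ψ r) (truncDomain r ε R) := by
  obtain ⟨M, hM0, hM⟩ := exists_abs_singularFactor_le (r := r) h1 hψ
  have hfin : volume (truncDomain r ε R) ≠ ⊤ := by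
    refine ne_top_of_le_ne_top (b := volume (Ioo 0 R)) (by simp) (measure_mono ?_)
    exact fun ξ hξ => ⟨hξ.1, hξ.2.1⟩
  refine Measure.integrableOn_of_bounded (M := M / (r * ε / (1 + ε))) hfin
    (measurable_singularPart hψ).aestronglyMeasurable ?_
  refine (ae_restrict_iff' measurableSet_truncDomain).2 (Eventually.of_forall fun ξ hξ => ?_)
  rw [singularPart, norm_div]
  exact div_le_div₀ hM0 (hM _) (by positivity) (abs_sub_ge_of_mem_truncDomain hε hξ)

lemma truncDomain_eq (hr : 0 < r) (h0 : 0 < ε) (h1 : ε < 1) (hR : r / (1 + ε) ≤ R) :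
    truncDomain r ε R = Ioo 0 (r / (1 + ε)) ∪ Ioo (r / (1 - ε)) R := by
  have h1' : 0 < 1 - ε := by linarith
  have h2' : 0 < 1 + ε := by linarith
  ext ξ
  simp only [truncDomain, mem_ofPred_eq, mem_union, mem_Ioo]
  have key : 0 < ξ → (ε < |r / ξ - 1| ↔ ξ < r / (1 + ε) ∨ r / (1 - ε) < ξ) := by
    intro hξ
    rw [lt_abs, lt_div_iff₀ h2', div_lt_iff₀ h1', neg_sub]
    have e1 : ε < r / ξ - 1 ↔ ξ * (1 + ε) < r := by
      rw [lt_sub_iff_add_lt, lt_div_iff₀ hξ]; constructor <;> intro <;> linarith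
    have e2 : ε < 1 - r / ξ ↔ r < ξ * (1 - ε) := by
      rw [lt_sub_comm, div_lt_iff₀ hξ]; constructor <;> intro <;> linarith
    rw [e1, e2]
  constructor
  · rintro ⟨a, b, c⟩
    rcases (key a).1 c with h | h
    · exact Or.inl ⟨a, h⟩
    · exact Or.inr ⟨h, b⟩
  · rintro (⟨a, b⟩ | ⟨a, b⟩)
    · exact ⟨a, by linarith, (key a).2 (Or.inl b)⟩
    · have : 0 < ξ := lt_trans (by positivity) a
      exact ⟨this, b, (key this).2 (Or.inr a)⟩

lemma setIntegral_truncDomain (hr : 0 < r) (h0 : 0 < ε) (h1 : ε < 1) (hR : r / (1 - ε) ≤ R)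
    {f : ℝ → ℝ} (hf : IntegrableOn f (truncDomain r ε R)) :
    IntervalIntegrable f volume 0 (r / (1 + ε)) ∧ IntervalIntegrable f volume (r / (1 - ε)) R ∧
    ∫ ξ in truncDomain r ε R, f ξ
      = (∫ ξ in (0 : ℝ)..(r / (1 + ε)), f ξ) + ∫ ξ in (r / (1 - ε))..R, f ξ := by
  have hle : r / (1 + ε) ≤ r / (1 - ε) :=
    div_le_div_of_nonneg_left hr.le (by linarith) (by linarith)
  rw [truncDomain_eq hr h0 h1 (hle.trans hR)] at hf ⊢
  have hp : 0 ≤ r / (1 + ε) := by positivity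
  have hd : Disjoint (Ioo 0 (r / (1 + ε))) (Ioo (r / (1 - ε)) R) :=
    Set.disjoint_left.2 fun ξ h h' => by linarith [h.2, h'.1]
  refine ⟨?_, ?_, ?_⟩
  · exact (intervalIntegrable_iff_integrableOn_Ioo_of_le hp).2 hf.left_of_union
  · exact (intervalIntegrable_iff_integrableOn_Ioo_of_le hR).2 hf.right_of_union
  · rw [setIntegral_union hd measurableSet_Ioo hf.left_of_union hf.right_of_union,
      intervalIntegral.integral_of_le hp, intervalIntegral.integral_of_le hR,
      integral_Ioc_eq_integral_Ioo, integral_Ioc_eq_integral_Ioo]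

lemma intervalIntegrable_singularFactor_div (h1 : γ < 1) (hψ : Continuous ψ) {a b : ℝ}
    (ha : 0 < a) (hb : 0 < b) :
    IntervalIntegrable (fun t => singularFactor γ ψ r t / t) volume a b := by
  obtain ⟨M, hM0, hM⟩ := exists_abs_singularFactor_le (r := r) h1 hψ
  have hc : IntervalIntegrable (fun t : ℝ => t⁻¹) volume a b := by
    refine (intervalIntegral.intervalIntegrable_inv (f := fun t => t) (fun t ht => ?_)
      continuousOn_id)
    exact ((lt_min ha hb).trans_le ht.1).ne'
  rw [intervalIntegrable_iff] at hc ⊢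
  simp only [div_eq_mul_inv]
  exact Integrable.bdd_mul (c := M) hc
    (measurable_singularFactor hψ).aestronglyMeasurable (Eventually.of_forall fun t => hM t)

/-- The excision in r/ξ is not symmetric about r: it reaches δ₁ to the left and δ₂ to the right. By
oddness only the mismatch (δ₁, δ₂) survives, of length O(ε²), on which the integrand is at most M/δ₁
= O(1/ε). -/
lemma abs_setIntegral_singularPart_le (h1 : γ < 1) (hψ : Continuous ψ) (hr : 0 < r) {M : ℝ}
    (hM0 : 0 ≤ M) (hM : ∀ t, |singularFactor γ ψ r t| ≤ M) (hε0 : 0 < ε) (hε1 : ε < 1 / 2)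
    (hR : 2 * r < R) :
    |∫ ξ in truncDomain r ε R, singularPart γ ψ r ξ| ≤ 4 * M * ε := by
  have hm : 0 < 1 - ε := by linarith
  have hp : 0 < 1 + ε := by linarith
  have hB : r / (1 - ε) < 2 * r := by rw [div_lt_iff₀ hm]; nlinarith
  have hI := integrableOn_singularPart_truncDomain (R := R) h1 hψ hr hε0
  obtain ⟨-, -, hv⟩ := setIntegral_truncDomain hr hε0 (by linarith) (by linarith) hI
  set δ₁ := r * ε / (1 + ε) with hδ₁
  set δ₂ := r * ε / (1 - ε) with hδ₂
  have hδ₁0 : 0 < δ₁ := by positivity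
  have hδ₂0 : 0 < δ₂ := by positivity
  have hA : r / (1 + ε) = r - δ₁ := by rw [hδ₁]; field_simp; ring
  have hB' : r / (1 - ε) = r + δ₂ := by rw [hδ₂]; field_simp; ring
  set q : ℝ → ℝ := fun t => singularFactor γ ψ r t / t with hq
  have e1 : ∫ ξ in (0 : ℝ)..(r / (1 + ε)), singularPart γ ψ r ξ = -∫ t in δ₁..r, q t := by
    have h := intervalIntegral.integral_comp_sub_left (a := δ₁) (b := r) (singularPart γ ψ r) r
    rw [sub_self] at h
    rw [hA, ← h, ← intervalIntegral.integral_neg]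
    refine intervalIntegral.integral_congr fun t ht => ?_
    have hδr : δ₁ ≤ r := by rw [hδ₁, div_le_iff₀ hp]; nlinarith
    rw [uIcc_of_le hδr] at ht
    have ht0 : 0 < t := hδ₁0.trans_le ht.1
    simp [singularPart, hq, abs_of_pos ht0, div_neg]
  have e2 : ∫ ξ in (r / (1 - ε))..R, singularPart γ ψ r ξ = ∫ t in δ₂..(R - r), q t := by
    have h := intervalIntegral.integral_comp_add_left (a := δ₂) (b := R - r)
      (singularPart γ ψ r) r
    rw [add_sub_cancel] at h
    rw [hB', ← h]
    refine intervalIntegral.integral_congr fun t ht => ?_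
    rw [uIcc_of_le (by linarith)] at ht
    have ht0 : 0 < t := hδ₂0.trans_le ht.1
    simp [singularPart, hq, abs_of_pos ht0]
  have e3 : ∫ t in r..(R - r), q t = 0 := by
    rw [intervalIntegral.integral_congr (g := fun _ => (0 : ℝ)), intervalIntegral.integral_zero]
    intro t ht
    rw [uIcc_of_le (by linarith)] at ht
    simp [hq, singularFactor_of_le ht.1]
  have ii : ∀ {a b : ℝ}, 0 < a → 0 < b → IntervalIntegrable q volume a b := fun ha hb =>
    intervalIntegrable_singularFactor_div h1 hψ ha hb
  have e4 : ∫ ξ in truncDomain r ε R, singularPart γ ψ r ξ = -∫ t in δ₁..δ₂, q t := by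
    have a1 := intervalIntegral.integral_add_adjacent_intervals (ii hδ₁0 hδ₂0) (ii hδ₂0 hr)
    have a2 := intervalIntegral.integral_add_adjacent_intervals (ii hδ₂0 hr)
      (ii hr (by linarith : 0 < R - r))
    rw [hv, e1, e2, ← a1, ← a2, e3]
    ring
  have hδ : δ₁ ≤ δ₂ := div_le_div_of_nonneg_left (by positivity) hm (by linarith)
  have hbound := intervalIntegral.norm_integral_le_of_norm_le_const (a := δ₁) (b := δ₂) (f := q)
    (C := M / δ₁) (fun t ht => by
      rw [uIoc_of_le hδ] at ht
      rw [hq, norm_div, Real.norm_eq_abs, Real.norm_eq_abs t, abs_of_pos (hδ₁0.trans ht.1)]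
      exact div_le_div₀ hM0 (hM t) hδ₁0 ht.1.le)
  rw [e4, abs_neg, ← Real.norm_eq_abs]
  refine hbound.trans ?_
  rw [abs_of_nonneg (by linarith)]
  have : M / δ₁ * (δ₂ - δ₁) = M * (2 * ε / (1 - ε)) := by
    rw [hδ₁, hδ₂]; field_simp; ring
  rw [this, show 4 * M * ε = M * (4 * ε) by ring]
  refine mul_le_mul_of_nonneg_left ?_ hM0
  rw [div_le_iff₀ hm]
  nlinarith

lemma tendsto_setIntegral_singularPart (h1 : γ < 1) (hψ : Continuous ψ) (hr : 0 < r) :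
    Tendsto (fun p : ℝ × ℝ => ∫ ξ in truncDomain r p.1 p.2, singularPart γ ψ r ξ)
      (𝓝[>] (0 : ℝ) ×ˢ atTop) (𝓝 0) := by
  obtain ⟨M, hM0, hM⟩ := exists_abs_singularFactor_le (r := r) h1 hψ
  have hlim : Tendsto (fun p : ℝ × ℝ => 4 * M * p.1) (𝓝[>] (0 : ℝ) ×ˢ atTop) (𝓝 0) := by
    have : Tendsto (fun ε : ℝ => 4 * M * ε) (𝓝[>] (0 : ℝ)) (𝓝 0) := by
      have := ((continuous_const_mul (4 * M)).tendsto (0 : ℝ)).mono_left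
        (nhdsWithin_le_nhds (s := Ioi 0))
      simpa using this
    exact this.comp tendsto_fst
  refine squeeze_zero_norm' ?_ hlim
  have he : ∀ᶠ ε : ℝ in 𝓝[>] (0 : ℝ), ε ∈ Ioo (0 : ℝ) (1 / 2) :=
    Ioo_mem_nhdsGT (by norm_num)
  filter_upwards [he.prod_mk (eventually_gt_atTop (2 * r))] with p hp
  exact abs_setIntegral_singularPart_le h1 hψ hr hM0 hM hp.1.1 hp.1.2 hp.2

lemma truncConv_mul_eq {ξ : ℝ} (hξ : ξ ≤ R) :
    truncConv γ ψ ξ ξ * (1 / (ξ - r) + 1 / (ξ + r))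
      = regularPart γ ψ r R ξ + singularPart γ ψ r ξ := by
  rw [regularPart, sub_add_cancel, truncConv_eq_self hξ]

lemma integrableOn_truncConv_mul (h0 : 0 < γ) (h1 : γ < 1) (hψ : Continuous ψ) (hr : 0 < r)
    (hε : 0 < ε) :
    IntegrableOn (fun ξ => truncConv γ ψ ξ ξ * (1 / (ξ - r) + 1 / (ξ + r)))
      (truncDomain r ε R) := by
  have hreg := (integrable_regularPart_and_integral h0 h1 hψ hr
    (lt_of_lt_of_le (lt_add_one r) (le_max_right R (r + 1)))).1
  refine (integrableOn_congr_fun (fun ξ hξ => ?_) measurableSet_truncDomain).1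
    (hreg.integrableOn.add (integrableOn_singularPart_truncDomain h1 hψ hr hε))
  exact (truncConv_mul_eq (hξ.2.1.le.trans (le_max_left R (r + 1)))).symm

lemma regularPart_congr {R' ξ : ℝ} (h : ξ ≤ R) (h' : ξ ≤ R') :
    regularPart γ ψ r R ξ = regularPart γ ψ r R' ξ := by
  rw [regularPart, regularPart, truncConv_eq_self h, truncConv_eq_self h']

lemma tendsto_principalValue (h0 : 0 < γ) (h1 : γ < 1) (hψ : Continuous ψ) (hr : 0 < r) {P : ℝ}
    (hP : Tendsto (fun R => ∫ ξ in (0 : ℝ)..R, regularPart γ ψ r R ξ) atTop (𝓝 P)) :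
    Tendsto (fun p : ℝ × ℝ => ∫ ξ in truncDomain r p.1 p.2,
        truncConv γ ψ ξ ξ * (1 / (ξ - r) + 1 / (ξ + r)))
      (𝓝[>] (0 : ℝ) ×ˢ atTop) (𝓝 P) := by
  have hreg : ∀ {R}, r < R → Integrable (regularPart γ ψ r R) := fun hR =>
    (integrable_regularPart_and_integral h0 h1 hψ hr hR).1
  have hii : ∀ {R} (a b : ℝ), r < R → IntervalIntegrable (regularPart γ ψ r R) volume a b :=
    fun a b hR => (hreg hR).intervalIntegrable
  have h2r : r < 2 * r := by linarith
  -- The excised interval lies below 2r once ε < 1/2. There the regular part does not depend on the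
  -- cut-off R ≥ 2r, so the value 2r serves for all of them and the joint limit in (ε, R) separates.
  have hmid : Tendsto (fun ε : ℝ =>
      ∫ ξ in (r / (1 + ε))..(r / (1 - ε)), regularPart γ ψ r (2 * r) ξ) (𝓝[>] 0) (𝓝 0) := by
    have hc := intervalIntegral.continuous_primitive (fun a b => hii a b h2r) 0
    have hA : Tendsto (fun ε : ℝ => r / (1 + ε)) (𝓝[>] 0) (𝓝 r) := by
      have : ContinuousAt (fun ε : ℝ => r / (1 + ε)) 0 :=
        continuousAt_const.div (by fun_prop) (by norm_num)
      simpa using this.tendsto.mono_left (nhdsWithin_le_nhds (s := Ioi 0))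
    have hB : Tendsto (fun ε : ℝ => r / (1 - ε)) (𝓝[>] 0) (𝓝 r) := by
      have : ContinuousAt (fun ε : ℝ => r / (1 - ε)) 0 :=
        continuousAt_const.div (by fun_prop) (by norm_num)
      simpa using this.tendsto.mono_left (nhdsWithin_le_nhds (s := Ioi 0))
    have := ((hc.tendsto r).comp hB).sub ((hc.tendsto r).comp hA)
    rw [sub_self] at this
    refine this.congr fun ε => ?_
    simp only [Function.comp]
    rw [intervalIntegral.integral_interval_sub_left (hii _ _ h2r) (hii _ _ h2r)]
  have hmain := ((hP.comp (tendsto_snd (f := 𝓝[>] (0 : ℝ)))).sub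
    (hmid.comp (tendsto_fst (g := (atTop : Filter ℝ))))).add
    (tendsto_setIntegral_singularPart (γ := γ) h1 hψ hr)
  rw [sub_zero, add_zero] at hmain
  refine hmain.congr' ?_
  have he : ∀ᶠ ε : ℝ in 𝓝[>] (0 : ℝ), ε ∈ Ioo (0 : ℝ) (1 / 2) :=
    Ioo_mem_nhdsGT (by norm_num)
  filter_upwards [he.prod_mk (eventually_gt_atTop (2 * r))] with ⟨ε, R⟩ ⟨⟨hε0, hε1⟩, hR⟩
  simp only [Function.comp] at hR hε0 hε1 ⊢
  have hR' : r < R := by linarith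
  have hm : 0 < 1 - ε := by linarith
  have hB : r / (1 - ε) < 2 * r := by rw [div_lt_iff₀ hm]; nlinarith
  have hAB : r / (1 + ε) ≤ r / (1 - ε) :=
    div_le_div_of_nonneg_left hr.le (by linarith) (by linarith)
  have hsI := integrableOn_singularPart_truncDomain (R := R) h1 hψ hr hε0
  have hrI : IntegrableOn (regularPart γ ψ r R) (truncDomain r ε R) := (hreg hR').integrableOn
  rw [setIntegral_congr_fun measurableSet_truncDomain fun ξ hξ =>
    truncConv_mul_eq (hξ.2.1.le : ξ ≤ R), integral_add hrI hsI]
  congr 1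
  rw [(setIntegral_truncDomain hr hε0 (by linarith) (by linarith) hrI).2.2]
  have hmidR : ∫ ξ in (r / (1 + ε))..(r / (1 - ε)), regularPart γ ψ r (2 * r) ξ
      = ∫ ξ in (r / (1 + ε))..(r / (1 - ε)), regularPart γ ψ r R ξ := by
    refine intervalIntegral.integral_congr fun ξ hξ => ?_
    rw [uIcc_of_le hAB] at hξ
    exact regularPart_congr (by linarith [hξ.2]) (by linarith [hξ.2])
  rw [hmidR, ← intervalIntegral.integral_add_adjacent_intervals
      (hii 0 (r / (1 + ε)) hR') (hii (r / (1 + ε)) R hR'),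
    ← intervalIntegral.integral_add_adjacent_intervals
      (hii (r / (1 + ε)) (r / (1 - ε)) hR') (hii (r / (1 - ε)) R hR')]
  ring

end PrincipalValue

/-! ### The error of the cut-off: the range ξ > R. -/

section Tail

variable {γ r R : ℝ} {ψ H : ℝ → ℝ}

/-- Integrating by parts replaces ψ by H, whose size is controlled. The weight (ξ-y)^(-γ) increases
in y, so boundary terms and variation add up to 2 S times its value at R. -/
lemma abs_truncConv_le (h0 : 0 < γ) (hψ : Continuous ψ) (hH : ∀ y, HasDerivAt H (ψ y) y)
    (hR : 0 ≤ R) {S : ℝ} (hS : ∀ y ∈ Icc 0 R, |H y| ≤ S) {ξ : ℝ} (hξ : R < ξ) :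
    |truncConv γ ψ R ξ| ≤ 2 * S * truncPow γ (ξ - R) := by
  have hpos : ∀ y ∈ Icc 0 R, 0 < ξ - y := fun y hy => by linarith [hy.2]
  have e : truncConv γ ψ R ξ = ∫ y in (0 : ℝ)..R, (ξ - y) ^ (-γ) * ψ y := by
    rw [truncConv, intervalIntegral.integral_of_le hR]
    refine setIntegral_congr_fun measurableSet_Ioc fun y hy => ?_
    rw [truncPow_of_pos (hpos y ⟨hy.1.le, hy.2⟩), mul_comm]
  set u : ℝ → ℝ := fun y => (ξ - y) ^ (-γ) with hu
  set u' : ℝ → ℝ := fun y => γ * (ξ - y) ^ (-γ - 1) with hu'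
  have hud : ∀ y ∈ uIcc 0 R, HasDerivAt u (u' y) y := by
    intro y hy
    rw [uIcc_of_le hR] at hy
    have := ((hasDerivAt_id y).const_sub ξ).rpow_const (p := -γ) (Or.inl (hpos y hy).ne')
    convert! this using 1
    simp [hu']
  have hu'c : ContinuousOn u' (uIcc 0 R) := by
    rw [uIcc_of_le hR]
    exact continuousOn_const.mul (ContinuousOn.rpow_const (by fun_prop)
      fun y hy => Or.inl (hpos y hy).ne')
  have hu'i := hu'c.intervalIntegrable (μ := volume)
  have hHc : Continuous H := continuous_iff_continuousAt.2 fun y => (hH y).continuousAt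
  have hu'0 : ∀ y ∈ Icc 0 R, 0 ≤ u' y := fun y hy =>
    mul_nonneg h0.le (Real.rpow_nonneg (hpos y hy).le _)
  have hparts := intervalIntegral.integral_mul_deriv_eq_deriv_mul hud (fun y _ => hH y) hu'i
    (hψ.intervalIntegrable 0 R)
  have hftc := intervalIntegral.integral_eq_sub_of_hasDerivAt hud hu'i
  have hbound : |∫ y in (0 : ℝ)..R, u' y * H y| ≤ (u R - u 0) * S := by
    rw [← hftc, ← intervalIntegral.integral_mul_const, ← Real.norm_eq_abs]
    refine intervalIntegral.norm_integral_le_of_norm_le hR ?_ (hu'i.mul_const S)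
    refine Eventually.of_forall fun y hy => ?_
    have hy' : y ∈ Icc 0 R := ⟨hy.1.le, hy.2⟩
    rw [norm_mul, Real.norm_of_nonneg (hu'0 y hy')]
    exact mul_le_mul_of_nonneg_left (hS y hy') (hu'0 y hy')
  have huR : 0 ≤ u R := Real.rpow_nonneg (by linarith) _
  have hu0 : 0 ≤ u 0 := Real.rpow_nonneg (by linarith) _
  have b1 : |u R * H R| ≤ u R * S := by
    rw [abs_mul, abs_of_nonneg huR]
    exact mul_le_mul_of_nonneg_left (hS R ⟨hR, le_rfl⟩) huR
  have b2 : |u 0 * H 0| ≤ u 0 * S := by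
    rw [abs_mul, abs_of_nonneg hu0]
    exact mul_le_mul_of_nonneg_left (hS 0 ⟨le_rfl, hR⟩) hu0
  rw [e, hparts, truncPow_of_pos (by linarith)]
  change _ ≤ 2 * S * u R
  rw [abs_le] at *
  constructor <;> linarith [b1.1, b1.2, b2.1, b2.2, hbound.1, hbound.2]

lemma abs_integral_regularPart_Ioi_le (h0 : 0 < γ) (h1 : γ < 1) (hψ : Continuous ψ)
    (hH : ∀ y, HasDerivAt H (ψ y) y) (hr : 0 < r) (hR : 2 * r < R) {S : ℝ}
    (hS : ∀ y ∈ Icc 0 R, |H y| ≤ S) :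
    |∫ ξ in Ioi R, regularPart γ ψ r R ξ|
      ≤ 6 * S * (R ^ (-γ) * (Real.pi / Real.sin (Real.pi * γ))) := by
  have hR0 : 0 < R := by linarith
  obtain ⟨hi, hv⟩ := integrable_stieltjesKernel_and_integral h0 h1
  have hS0 : 0 ≤ S := (abs_nonneg _).trans (hS 0 ⟨le_rfl, hR0.le⟩)
  have hki := (integrable_scaled_kernel (γ := γ) hi hR0 R).const_mul (6 * S)
  have hknn : ∀ ξ, 0 ≤ 6 * S * (R ^ (-γ - 1) * stieltjesKernel γ ((ξ - R) / R)) := by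
    intro ξ
    rw [scaled_stieltjesKernel hR0]
    -- The dominating function is the Stieltjes kernel with centre and scale both R, that is 6 S
    -- (ξ-R)₊^(-γ)/ξ. The 6 comes from 2 S in `abs_truncConv_le` times the bound 3/ξ for the two
    -- pole terms.
    rcases le_or_gt ξ R with h | h
    · rw [truncPow_of_nonpos (by linarith)]; simp
    · exact mul_nonneg (by positivity) (div_nonneg (truncPow_nonneg _ _) (by linarith))
  rw [← hv, ← integral_scaled_kernel (γ := γ) _ hR0 R, ← integral_const_mul, ← Real.norm_eq_abs]
  refine le_trans (norm_integral_le_of_norm_le hki.integrableOn ?_)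
    (setIntegral_le_integral hki (Eventually.of_forall hknn))
  refine (ae_restrict_iff' measurableSet_Ioi).2 (Eventually.of_forall fun ξ hξ => ?_)
  have hξ : R < ξ := hξ
  have hξ0 : 0 < ξ := by linarith
  have hw : 0 ≤ 1 / (ξ - r) + 1 / (ξ + r) :=
    add_nonneg (one_div_nonneg.2 (by linarith)) (one_div_nonneg.2 (by linarith))
  have hw' : 1 / (ξ - r) + 1 / (ξ + r) ≤ 3 / ξ := by
    have a1 : 1 / (ξ - r) ≤ 2 / ξ := by
      rw [div_le_div_iff₀ (by linarith) hξ0]; linarith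
    have a2 : 1 / (ξ + r) ≤ 1 / ξ := by
      rw [div_le_div_iff₀ (by linarith) hξ0]; linarith
    calc _ ≤ 2 / ξ + 1 / ξ := add_le_add a1 a2
      _ = 3 / ξ := by ring
  rw [regularPart, singularPart_of_two_mul_le (by linarith), sub_zero, norm_mul,
    Real.norm_of_nonneg hw, scaled_stieltjesKernel hR0, sub_add_cancel, Real.norm_eq_abs]
  calc _ ≤ (2 * S * truncPow γ (ξ - R)) * (3 / ξ) :=
        mul_le_mul (abs_truncConv_le h0 hψ hH hR0.le hS hξ) hw' hw
          (mul_nonneg (by positivity) (truncPow_nonneg _ _))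
    _ = _ := by ring

lemma tendsto_integral_regularPart_Ioi (h0 : 0 < γ) (h1 : γ < 1) (hψ : Continuous ψ)
    (hH : ∀ y, HasDerivAt H (ψ y) y) (hr : 0 < r) {C q : ℝ} (hq0 : 0 ≤ q) (hq : q < γ)
    (hHb : ∀ y, |H y| ≤ C * (1 + |y|) ^ q) :
    Tendsto (fun R => ∫ ξ in Ioi R, regularPart γ ψ r R ξ) atTop (𝓝 0) := by
  have hC : 0 ≤ C := by simpa using (abs_nonneg _).trans (hHb 0)
  set K : ℝ := 6 * (C * 2 ^ q) * (Real.pi / Real.sin (Real.pi * γ)) with hK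
  have hlim : Tendsto (fun R : ℝ => K * R ^ (-(γ - q))) atTop (𝓝 0) := by
    simpa using (tendsto_rpow_neg_atTop (by linarith : 0 < γ - q)).const_mul K
  refine squeeze_zero_norm' ?_ hlim
  filter_upwards [eventually_gt_atTop (2 * r), eventually_ge_atTop 1] with R hR hR1
  have hR0 : 0 < R := by linarith
  have hS : ∀ y ∈ Icc 0 R, |H y| ≤ C * 2 ^ q * R ^ q := by
    intro y hy
    refine (hHb y).trans ?_
    rw [mul_assoc, ← Real.mul_rpow two_pos.le hR0.le, abs_of_nonneg hy.1]
    exact mul_le_mul_of_nonneg_left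
      (Real.rpow_le_rpow (by linarith [hy.1]) (by linarith [hy.2]) hq0) hC
  refine (abs_integral_regularPart_Ioi_le h0 h1 hψ hH hr hR hS).trans (le_of_eq ?_)
  rw [hK, show -(γ - q) = q + -γ by ring, Real.rpow_add hR0]
  ring

end Tail

/-! ### Improper integration by parts against a power. -/

section ImproperParts

variable {u u' : ℝ → ℝ} {a b β K C : ℝ}

lemma integrableOn_div_rpow (hu : Continuous u) (hb : b < β) (ha : β < a)
    (h0 : ∀ z, 0 < z → z ≤ 1 → |u z| ≤ K * z ^ a) (hinf : ∀ z, 1 ≤ z → |u z| ≤ C * z ^ b) :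
    IntegrableOn (fun z => u z / z ^ (1 + β)) (Ioi 0) := by
  have hm : AEStronglyMeasurable (fun z : ℝ => u z / z ^ (1 + β)) volume :=
    (hu.measurable.div (measurable_id.pow_const _)).aestronglyMeasurable
  have key : ∀ {z c M : ℝ}, 0 < z → |u z| ≤ M * z ^ c →
      ‖u z / z ^ (1 + β)‖ ≤ M * z ^ (c - (1 + β)) := by
    intro z c M hz h
    have hp := Real.rpow_pos_of_pos hz (1 + β)
    rw [norm_div, Real.norm_of_nonneg hp.le, Real.rpow_sub hz, ← mul_div_assoc]
    exact div_le_div_of_nonneg_right h hp.le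
  rw [← Ioc_union_Ioi_eq_Ioi (zero_le_one' ℝ)]
  refine IntegrableOn.union ?_ ?_
  · have hi : IntegrableOn (fun z : ℝ => K * z ^ (a - (1 + β))) (Ioc 0 1) := by
      have := intervalIntegral.intervalIntegrable_rpow' (a := 0) (b := 1) (r := a - (1 + β))
        (by linarith)
      rw [intervalIntegrable_iff_integrableOn_Ioc_of_le zero_le_one] at this
      exact this.const_mul K
    exact Integrable.mono' hi hm.restrict ((ae_restrict_iff' measurableSet_Ioc).2
      (Eventually.of_forall fun z hz => key hz.1 (h0 z hz.1 hz.2)))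
  · have hi : IntegrableOn (fun z : ℝ => C * z ^ (b - (1 + β))) (Ioi 1) :=
      (integrableOn_Ioi_rpow_of_lt (by linarith) one_pos).const_mul C
    exact Integrable.mono' hi hm.restrict ((ae_restrict_iff' measurableSet_Ioi).2
      (Eventually.of_forall fun z hz => key (one_pos.trans hz) (hinf z (le_of_lt hz))))

lemma tendsto_integral_deriv_mul_rpow_neg (hu : ∀ z, HasDerivAt u (u' z) z) (hb : b < β)
    (ha : β < a) (h0 : ∀ z, 0 < z → z ≤ 1 → |u z| ≤ K * z ^ a)
    (hinf : ∀ z, 1 ≤ z → |u z| ≤ C * z ^ b)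
    (hi : ∀ T, 0 < T → IntervalIntegrable (fun z => u' z * z ^ (-β)) volume 0 T) :
    Tendsto (fun T => ∫ z in (0 : ℝ)..T, u' z * z ^ (-β)) atTop
      (𝓝 (β * ∫ z in Ioi 0, u z / z ^ (1 + β))) := by
  have hc : Continuous u := continuous_iff_continuousAt.2 fun z => (hu z).continuousAt
  have hI := integrableOn_div_rpow hc hb ha h0 hinf
  have hW : ∀ {z c M : ℝ}, 0 < z → |u z| ≤ M * z ^ c → ‖u z * z ^ (-β)‖ ≤ M * z ^ (c - β) := by
    intro z c M hz h
    have hp := Real.rpow_pos_of_pos hz (-β)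
    rw [norm_mul, Real.norm_of_nonneg hp.le, sub_eq_add_neg, Real.rpow_add hz, ← mul_assoc]
    exact mul_le_mul_of_nonneg_right h hp.le
  have hW0 : Tendsto (fun z => u z * z ^ (-β)) (𝓝[>] 0) (𝓝 0) := by
    have hl : Tendsto (fun z : ℝ => K * z ^ (a - β)) (𝓝[>] 0) (𝓝 0) := by
      have := ((Real.continuousAt_rpow_const 0 (a - β) (Or.inr (by linarith))).tendsto.const_mul
        K).mono_left (nhdsWithin_le_nhds (s := Ioi 0))
      rwa [Real.zero_rpow (by linarith), mul_zero] at this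
    refine squeeze_zero_norm' ?_ hl
    filter_upwards [Ioc_mem_nhdsGT (one_pos (α := ℝ))] with z hz
    exact hW hz.1 (h0 z hz.1 hz.2)
  have hW1 : Tendsto (fun z => u z * z ^ (-β)) atTop (𝓝 0) := by
    have hl : Tendsto (fun z : ℝ => C * z ^ (b - β)) atTop (𝓝 0) := by
      have := (tendsto_rpow_neg_atTop (by linarith : 0 < β - b)).const_mul C
      simpa using this
    refine squeeze_zero_norm' ?_ hl
    filter_upwards [eventually_ge_atTop 1] with z hz
    exact hW (by linarith) (hinf z hz)
  have hlim := (intervalIntegral_tendsto_integral_Ioi 0 hI tendsto_id).const_mul β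
  have hsum := hlim.add hW1
  rw [add_zero] at hsum
  refine hsum.congr' ?_
  filter_upwards [eventually_gt_atTop 0] with T hT
  have hIT : IntervalIntegrable (fun z => β * (u z / z ^ (1 + β))) volume 0 T :=
    ((intervalIntegrable_iff_integrableOn_Ioc_of_le hT.le).2
      (hI.mono_set Ioc_subset_Ioi_self)).const_mul β
  have hftc := intervalIntegral.integral_eq_sub_of_hasDerivAt_of_tendsto hT
    (f := fun z => u z * z ^ (-β)) (f' := fun z => u' z * z ^ (-β) - β * (u z / z ^ (1 + β)))
    (fun z hz => by
      have := (hu z).mul (Real.hasDerivAt_rpow_const (p := -β) (Or.inl hz.1.ne'))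
      convert! this using 1
      rw [show (-β - 1) = -(1 + β) by ring, Real.rpow_neg hz.1.le (1 + β)]
      ring)
    ((hi T hT).sub hIT) hW0
    (((hu T).continuousAt.mul (Real.continuousAt_rpow_const T (-β) (Or.inl hT.ne'))).tendsto.mono_left
      nhdsWithin_le_nhds)
  rw [intervalIntegral.integral_sub (hi T hT) hIT, sub_zero,
    intervalIntegral.integral_const_mul] at hftc
  simp only [id, Pi.mul_apply] at hftc ⊢
  linarith

end ImproperParts

/-! ### One-sided increments of H and the limit of the regular part. -/

section Increments

variable {γ r σ C q : ℝ} {ψ H : ℝ → ℝ}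

lemma hasDerivAt_increment (hH : ∀ y, HasDerivAt H (ψ y) y) (r σ z : ℝ) :
    HasDerivAt (fun z => H (r + σ * z) - H r) (σ * ψ (r + σ * z)) z := by
  have h1 : HasDerivAt (fun z => r + σ * z) σ z := by
    simpa using ((hasDerivAt_id z).const_mul σ).const_add r
  have := ((hH (r + σ * z)).comp z h1).sub_const (H r)
  rwa [mul_comm] at this

lemma exists_abs_increment_le (hψ : Continuous ψ) (hH : ∀ y, HasDerivAt H (ψ y) y) (r σ : ℝ) :
    ∃ K, 0 ≤ K ∧ ∀ z, 0 < z → z ≤ 1 → |H (r + σ * z) - H r| ≤ K * z ^ (1 : ℝ) := by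
  have hc : Continuous fun z => σ * ψ (r + σ * z) := by fun_prop
  obtain ⟨K, hK⟩ := isCompact_Icc.exists_bound_of_continuousOn (s := Icc (0 : ℝ) 1)
    hc.continuousOn
  refine ⟨K, (norm_nonneg _).trans (hK 0 (by simp)), fun z hz0 hz1 => ?_⟩
  have := (convex_Icc (0 : ℝ) 1).norm_image_sub_le_of_norm_hasDerivWithin_le
    (fun z _ => (hasDerivAt_increment hH r σ z).hasDerivWithinAt) hK
    (left_mem_Icc.2 zero_le_one) ⟨hz0.le, hz1⟩
  simpa [abs_of_pos hz0] using this

/-- For z ≥ 1 one has 1 + r + z ≤ (2 + r) z. Allowing σ = 0 makes the same bound cover the constant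
H(r). -/
lemma abs_le_of_growth (hr : 0 < r) (hσ : |σ| ≤ 1) (hC : 0 ≤ C) (hq0 : 0 ≤ q)
    (hHb : ∀ y, |H y| ≤ C * (1 + |y|) ^ q) {z : ℝ} (hz : 1 ≤ z) :
    |H (r + σ * z)| ≤ C * (2 + r) ^ q * z ^ q := by
  refine (hHb _).trans ?_
  rw [mul_assoc, ← Real.mul_rpow (by linarith) (by linarith)]
  refine mul_le_mul_of_nonneg_left (Real.rpow_le_rpow (by positivity) ?_ hq0) hC
  have h1 : |r + σ * z| ≤ r + 1 * z := by
    refine (abs_add_le _ _).trans ?_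
    rw [abs_of_pos hr, abs_mul, abs_of_nonneg (by linarith : 0 ≤ z)]
    gcongr
  nlinarith

lemma abs_increment_le_of_growth (hr : 0 < r) (hσ : |σ| = 1) (hC : 0 ≤ C) (hq0 : 0 ≤ q)
    (hHb : ∀ y, |H y| ≤ C * (1 + |y|) ^ q) {z : ℝ} (hz : 1 ≤ z) :
    |H (r + σ * z) - H r| ≤ 2 * (C * (2 + r) ^ q) * z ^ q := by
  have a1 := abs_le_of_growth hr hσ.le hC hq0 hHb hz
  have a2 := abs_le_of_growth (σ := 0) hr (by simp) hC hq0 hHb hz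
  rw [zero_mul, add_zero] at a2
  refine (abs_sub _ _).trans ?_
  linarith

lemma integrableOn_increment (h1 : γ < 1) (hψ : Continuous ψ)
    (hH : ∀ y, HasDerivAt H (ψ y) y) (hr : 0 < r) (hσ : |σ| = 1) (hC : 0 ≤ C)
    (hq0 : 0 ≤ q) (hq : q < γ) (hHb : ∀ y, |H y| ≤ C * (1 + |y|) ^ q) :
    IntegrableOn (fun z => (H (r + σ * z) - H r) / z ^ (1 + γ)) (Ioi 0) := by
  obtain ⟨K, -, hK⟩ := exists_abs_increment_le hψ hH r σ
  exact integrableOn_div_rpow (continuous_iff_continuousAt.2 fun z =>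
    (hasDerivAt_increment hH r σ z).continuousAt) hq h1 hK
    fun z hz => abs_increment_le_of_growth hr hσ hC hq0 hHb hz

lemma intervalIntegrable_mul_rpow_neg (h1 : γ < 1) {f : ℝ → ℝ} (hf : Continuous f) (a b : ℝ) :
    IntervalIntegrable (fun z => f z * z ^ (-γ)) volume a b :=
  (intervalIntegral.intervalIntegrable_rpow' (by linarith)).continuousOn_mul hf.continuousOn

lemma tendsto_integral_increment (h1 : γ < 1) (hψ : Continuous ψ)
    (hH : ∀ y, HasDerivAt H (ψ y) y) (hr : 0 < r) (hσ : |σ| = 1) (hC : 0 ≤ C)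
    (hq0 : 0 ≤ q) (hq : q < γ) (hHb : ∀ y, |H y| ≤ C * (1 + |y|) ^ q) :
    Tendsto (fun T => ∫ z in (0 : ℝ)..T, σ * ψ (r + σ * z) * z ^ (-γ)) atTop
      (𝓝 (γ * ∫ z in Ioi 0, (H (r + σ * z) - H r) / z ^ (1 + γ))) := by
  obtain ⟨K, -, hK⟩ := exists_abs_increment_le hψ hH r σ
  exact tendsto_integral_deriv_mul_rpow_neg (fun z => hasDerivAt_increment hH r σ z) hq h1 hK
    (fun z hz => abs_increment_le_of_growth hr hσ hC hq0 hHb hz)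
    fun T _ => intervalIntegrable_mul_rpow_neg h1 (by fun_prop) 0 T

lemma tendsto_integral_regularPart (h0 : 0 < γ) (h1 : γ < 1) (hψ : Continuous ψ)
    (hH : ∀ y, HasDerivAt H (ψ y) y) (hr : 0 < r) (hC : 0 ≤ C) (hq0 : 0 ≤ q) (hq : q < γ)
    (hHb : ∀ y, |H y| ≤ C * (1 + |y|) ^ q) {e : ℝ} (hpar : ∀ y, ψ (-y) = -e * ψ y) :
    Tendsto (fun R => ∫ ξ in (0 : ℝ)..R, regularPart γ ψ r R ξ) atTop
      (𝓝 (Real.pi * Real.cos (Real.pi * γ) / Real.sin (Real.pi * γ) * truncConv γ ψ r r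
        + Real.pi / Real.sin (Real.pi * γ)
          * (γ * ∫ z in Ioi 0, (H (r + 1 * z) - H r) / z ^ (1 + γ))
        + Real.pi / Real.sin (Real.pi * γ)
          * (e * ((γ * ∫ z in Ioi 0, (H (r + -1 * z) - H r) / z ^ (1 + γ))
            + truncConv γ ψ r r)))) := by
  have hT1 := (tendsto_integral_increment (σ := 1) h1 hψ hH hr (by simp) hC hq0 hq hHb).comp
    (tendsto_atTop_add_const_right atTop (-r) tendsto_id)
  have hT2 := (tendsto_integral_increment (σ := -1) h1 hψ hH hr (by simp) hC hq0 hq hHb).comp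
    (tendsto_atTop_add_const_right atTop r tendsto_id)
  have hlim := (((hT1.const_mul (Real.pi / Real.sin (Real.pi * γ))).const_add
    (Real.pi * Real.cos (Real.pi * γ) / Real.sin (Real.pi * γ) * truncConv γ ψ r r)).add
    (((hT2.add_const (truncConv γ ψ r r)).const_mul e).const_mul
      (Real.pi / Real.sin (Real.pi * γ)))).sub
    (tendsto_integral_regularPart_Ioi h0 h1 hψ hH hr hq0 hq hHb)
  rw [sub_zero] at hlim
  refine hlim.congr' ?_
  filter_upwards [eventually_gt_atTop r] with R hR
  have hR0 : 0 < R := hr.trans hR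
  obtain ⟨hreg, hregv⟩ := integrable_regularPart_and_integral h0 h1 hψ hr hR
  have hJ : truncConv γ ψ r r = ∫ y in Ioo 0 r, ψ y * (r - y) ^ (-γ) := by
    rw [truncConv, integral_Ioc_eq_integral_Ioo]
    refine setIntegral_congr_fun measurableSet_Ioo fun y hy => ?_
    rw [truncPow_of_pos (by linarith [hy.2])]
  have hJ' : truncConv γ ψ r r = ∫ z in (0 : ℝ)..r, ψ (r + -1 * z) * z ^ (-γ) := by
    rw [hJ, ← integral_Ioc_eq_integral_Ioo, ← intervalIntegral.integral_of_le hr.le]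
    have := intervalIntegral.integral_comp_sub_left (a := 0) (b := r)
      (fun y => ψ y * (r - y) ^ (-γ)) r
    rw [sub_self, sub_zero] at this
    rw [← this]
    refine intervalIntegral.integral_congr fun z _ => ?_
    rw [sub_sub_cancel, neg_one_mul, sub_eq_add_neg]
  have hA : ∫ z in (0 : ℝ)..(R + -r), 1 * ψ (r + 1 * z) * z ^ (-γ)
      = ∫ y in Ioc r R, ψ y * (y - r) ^ (-γ) := by
    rw [← intervalIntegral.integral_of_le hR.le]
    have := intervalIntegral.integral_comp_add_left (a := 0) (b := R + -r)
      (fun y => ψ y * (y - r) ^ (-γ)) r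
    rw [add_zero, show r + (R + -r) = R by ring] at this
    rw [← this]
    refine intervalIntegral.integral_congr fun z _ => ?_
    simp
  -- With z = y + r the parity of ψ yields an integral to the left of r starting at z = r;
  -- completing it down to z = 0 costs exactly `truncConv γ ψ r r`.
  have hB : e * ((∫ z in (0 : ℝ)..(R + r), -1 * ψ (r + -1 * z) * z ^ (-γ)) + truncConv γ ψ r r)
      = ∫ y in Ioc 0 R, ψ y * (y + r) ^ (-γ) := by
    rw [← intervalIntegral.integral_of_le hR0.le]
    have := intervalIntegral.integral_comp_add_right (a := 0) (b := R)
      (fun z => ψ (z - r) * z ^ (-γ)) r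
    rw [zero_add] at this
    simp only [add_sub_cancel_right] at this
    have hc : Continuous fun z => ψ (r + -1 * z) := by fun_prop
    have hadj := intervalIntegral.integral_add_adjacent_intervals
      (intervalIntegrable_mul_rpow_neg h1 hc 0 r) (intervalIntegrable_mul_rpow_neg h1 hc r (R + r))
    have hneg : ∫ z in (0 : ℝ)..(R + r), -1 * ψ (r + -1 * z) * z ^ (-γ)
        = -∫ z in (0 : ℝ)..(R + r), ψ (r + -1 * z) * z ^ (-γ) := by
      rw [← intervalIntegral.integral_neg]
      refine intervalIntegral.integral_congr fun z _ => ?_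
      ring
    have hpsi : ∫ z in r..(R + r), ψ (z - r) * z ^ (-γ)
        = -e * ∫ z in r..(R + r), ψ (r + -1 * z) * z ^ (-γ) := by
      rw [← intervalIntegral.integral_const_mul]
      refine intervalIntegral.integral_congr fun z _ => ?_
      rw [← mul_assoc, ← hpar]
      congr 2; ring
    rw [this, hpsi, hneg, ← hadj, hJ']
    ring
  have hsplit : ∫ ξ, regularPart γ ψ r R ξ
      = (∫ ξ in (0 : ℝ)..R, regularPart γ ψ r R ξ) + ∫ ξ in Ioi R, regularPart γ ψ r R ξ := by
    have e1 : ∫ ξ, regularPart γ ψ r R ξ = ∫ ξ in Ioi 0, regularPart γ ψ r R ξ :=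
      (setIntegral_eq_integral_of_forall_compl_eq_zero fun ξ hξ =>
        regularPart_of_nonpos (not_lt.1 hξ)).symm
    rw [e1, ← Ioc_union_Ioi_eq_Ioi hR0.le, setIntegral_union (Ioc_disjoint_Ioi le_rfl)
      measurableSet_Ioi hreg.integrableOn hreg.integrableOn,
      intervalIntegral.integral_of_le hR0.le]
  simp only [Function.comp, id]
  rw [sub_eq_iff_eq_add, ← hsplit, hregv, hA, hB, ← hJ]

end Increments

/-! ### Evaluation of the kernel convolution. -/

lemma rlIntegral_eq_truncConv {γ : ℝ} (h0 : 0 < γ) (ψ : ℝ → ℝ) {ξ : ℝ} (hξ : 0 < ξ) :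
    rlIntegral (1 - γ) ψ ξ = 1 / Real.Gamma (1 - γ) * truncConv γ ψ ξ ξ := by
  rw [rlIntegral, truncConv, intervalIntegral.integral_of_le hξ.le]
  congr 1
  refine setIntegral_congr_fun measurableSet_Ioc fun τ hτ => ?_
  rw [mul_comm, show 1 - γ - 1 = -γ by ring]
  rcases eq_or_lt_of_le hτ.2 with rfl | h
  -- At τ = ξ the convention 0^(-γ) = 0 agrees with the truncated power.
  · rw [sub_self, Real.zero_rpow (by linarith), truncPow_of_nonpos le_rfl]
  · rw [truncPow_of_pos (by linarith)]

lemma kernelFun_div_eq (α : ℝ) {r ξ : ℝ} (hr : 0 < r) (hξ : 0 < ξ) (hne : ξ - r ≠ 0) :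
    kernelFun α (r / ξ) / ξ
      = Real.sin (Real.pi * α / 2) / Real.pi * (1 / (ξ - r) + 1 / (ξ + r)) := by
  have h2 : ξ + r ≠ 0 := by positivity
  have h3 : ξ ^ 2 - r ^ 2 ≠ 0 := by
    rw [sq_sub_sq]; exact mul_ne_zero h2 hne
  have e : 1 - (r / ξ) ^ 2 = (ξ ^ 2 - r ^ 2) / ξ ^ 2 := by field_simp
  have e' : 1 / (ξ - r) + 1 / (ξ + r) = 2 * ξ / (ξ ^ 2 - r ^ 2) := by
    rw [div_add_div _ _ hne h2, sq_sub_sq, mul_comm (ξ + r)]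
    ring
  rw [kernelFun, e, e']
  field_simp

/-- The total coefficient of J, up to a common factor: the three terms come from the pole -r, the
pole r and the delta part. Its vanishing is what fixes the delta coefficient in the kernel. -/
lemma sin_half_combination (n : ℕ) (α : ℝ) :
    (-1) ^ n * Real.sin (Real.pi * α / 2)
      + Real.sin (Real.pi * α / 2) * Real.cos (Real.pi * (α - n))
      - Real.cos (Real.pi * α / 2) * Real.sin (Real.pi * (α - n)) = 0 := by
  rw [add_sub_assoc, ← Real.sin_sub,
    show Real.pi * α / 2 - Real.pi * (α - n) = n * Real.pi - Real.pi * α / 2 by ring,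
    Real.sin_sub, Real.sin_nat_mul_pi, Real.cos_nat_mul_pi]
  ring

lemma hasKernelConvolution_rlIntegral {γ r C q : ℝ} {ψ H : ℝ → ℝ} (n : ℕ)
    (h0 : 0 < γ) (h1 : γ < 1) (hψ : Continuous ψ) (hH : ∀ y, HasDerivAt H (ψ y) y) (hr : 0 < r)
    (hC : 0 ≤ C) (hq0 : 0 ≤ q) (hq : q < γ) (hHb : ∀ y, |H y| ≤ C * (1 + |y|) ^ q)
    (hpar : ∀ y, ψ (-y) = -(-1) ^ n * ψ y) :
    HasKernelConvolution (γ + n) (rlIntegral (1 - γ) ψ) r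
      (Real.sin (Real.pi * (γ + n) / 2) * Real.Gamma (1 + γ) / Real.pi *
        ((∫ z in Ioi 0, (H (r + 1 * z) - H r) / z ^ (1 + γ))
          + (-1) ^ n * ∫ z in Ioi 0, (H (r + -1 * z) - H r) / z ^ (1 + γ))) := by
  set S := Real.sin (Real.pi * (γ + n) / 2) with hS
  set c := 1 / Real.Gamma (1 - γ) * (S / Real.pi) with hc
  have hpt : ∀ ε R : ℝ, 0 < ε → ∀ ξ ∈ truncDomain r ε R,
      c * (truncConv γ ψ ξ ξ * (1 / (ξ - r) + 1 / (ξ + r)))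
        = rlIntegral (1 - γ) ψ ξ * kernelFun (γ + n) (r / ξ) / ξ := by
    intro ε R hε ξ hξ
    have hne : ξ - r ≠ 0 := by
      have := abs_sub_ge_of_mem_truncDomain hε hξ
      exact abs_pos.1 (lt_of_lt_of_le (by positivity) this)
    rw [rlIntegral_eq_truncConv h0 ψ hξ.1, mul_div_assoc, kernelFun_div_eq _ hr hξ.1 hne]
    ring
  have hlim := (tendsto_principalValue h0 h1 hψ hr
    (tendsto_integral_regularPart h0 h1 hψ hH hr hC hq0 hq hHb hpar)).const_mul c
  refine ⟨fun ε hε R _ => ?_, _, hlim.congr' ?_, ?_⟩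
  · exact (integrableOn_congr_fun (hpt ε R hε) measurableSet_truncDomain).1
      ((integrableOn_truncConv_mul h0 h1 hψ hr hε).const_mul c)
  · have he : ∀ᶠ p : ℝ × ℝ in 𝓝[>] (0 : ℝ) ×ˢ atTop, 0 < p.1 :=
      tendsto_fst.eventually (eventually_mem_nhdsWithin : ∀ᶠ ε : ℝ in 𝓝[>] 0, ε ∈ Ioi (0 : ℝ))
    filter_upwards [he] with p hp
    rw [← integral_const_mul]
    exact setIntegral_congr_fun measurableSet_truncDomain (hpt p.1 p.2 hp)
  · rw [integral_dirac, kernelDeltaFactor, div_one, mul_one, div_one,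
      rlIntegral_eq_truncConv h0 ψ hr]
    set A₁ := ∫ z in Ioi 0, (H (r + 1 * z) - H r) / z ^ (1 + γ)
    set A₂ := ∫ z in Ioi 0, (H (r + -1 * z) - H r) / z ^ (1 + γ)
    set J := truncConv γ ψ r r
    have hsin : Real.sin (Real.pi * γ) ≠ 0 :=
      (Real.sin_pos_of_pos_of_lt_pi (by positivity) (by nlinarith [Real.pi_pos])).ne'
    have hΓ1 : Real.Gamma (1 - γ) ≠ 0 := (Real.Gamma_pos_of_pos (by linarith)).ne'
    -- The reflection formula converts 1/(Γ(1-γ) sin(πγ)) into the Gamma factor of the Riesz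
    -- normalisation.
    have hΓ : Real.Gamma γ = Real.pi / (Real.sin (Real.pi * γ) * Real.Gamma (1 - γ)) := by
      rw [← div_div, ← Real.Gamma_mul_Gamma_one_sub, mul_div_cancel_right₀ _ hΓ1]
    have htrig := sin_half_combination n (γ + n)
    rw [add_sub_cancel_right, ← hS] at htrig
    rw [add_comm 1 γ, Real.Gamma_add_one h0.ne', hΓ, hc]
    have hpi := Real.pi_ne_zero
    generalize Real.cos (Real.pi * (γ + n) / 2) = c₂ at *
    generalize Real.sin (Real.pi * γ) = s₁ at *
    generalize Real.cos (Real.pi * γ) = c₁ at *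
    field_simp
    linear_combination (-J) * htrig

/-! ### The Riesz integral in terms of increments. -/

lemma riesz_increment_sum {γ r C q : ℝ} {ψ H : ℝ → ℝ} (h1 : γ < 1) (hψ : Continuous ψ)
    (hH : ∀ y, HasDerivAt H (ψ y) y) (hr : 0 < r) (hC : 0 ≤ C) (hq0 : 0 ≤ q) (hq : q < γ)
    (hHb : ∀ y, |H y| ≤ C * (1 + |y|) ^ q) :
    IntegrableOn (rieszIntegrand γ H r) (Ioi 0) ∧
      ∫ z in Ioi 0, rieszIntegrand γ H r z
        = (∫ z in Ioi 0, (H (r + 1 * z) - H r) / z ^ (1 + γ))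
          + ∫ z in Ioi 0, (H (r + -1 * z) - H r) / z ^ (1 + γ) := by
  have I1 := integrableOn_increment (σ := 1) h1 hψ hH hr (by simp) hC hq0 hq hHb
  have I2 := integrableOn_increment (σ := -1) h1 hψ hH hr (by simp) hC hq0 hq hHb
  have e : rieszIntegrand γ H r = fun z => (H (r + 1 * z) - H r) / z ^ (1 + γ)
      + (H (r + -1 * z) - H r) / z ^ (1 + γ) := by
    ext z
    rw [rieszIntegrand, ← add_div, one_mul, neg_one_mul, ← sub_eq_add_neg]
    congr 1; ring
  rw [e]
  exact ⟨I1.add I2, integral_add I1 I2⟩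

/-- The second difference u of f has u'(z) = H(r+z) - H(r-z), which is O(z) near 0, so u = O(z²) and
one integration by parts with β = 1 + γ < 2 is legitimate. -/
lemma riesz_increment_sub {γ r C q C' q' : ℝ} {f ψ H : ℝ → ℝ} (h1 : γ < 1)
    (hψ : Continuous ψ) (hf : ∀ y, HasDerivAt f (H y) y) (hH : ∀ y, HasDerivAt H (ψ y) y)
    (hr : 0 < r) (hC : 0 ≤ C) (hq0 : 0 ≤ q) (hq : q < γ) (hHb : ∀ y, |H y| ≤ C * (1 + |y|) ^ q)
    (hC' : 0 ≤ C') (hq0' : 0 ≤ q') (hq' : q' < 1 + γ) (hfb : ∀ y, |f y| ≤ C' * (1 + |y|) ^ q') :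
    IntegrableOn (rieszIntegrand (1 + γ) f r) (Ioi 0) ∧
      (1 + γ) * ∫ z in Ioi 0, rieszIntegrand (1 + γ) f r z
        = (∫ z in Ioi 0, (H (r + 1 * z) - H r) / z ^ (1 + γ))
          - ∫ z in Ioi 0, (H (r + -1 * z) - H r) / z ^ (1 + γ) := by
  set u : ℝ → ℝ := fun z => f (r + z) - 2 * f r + f (r - z) with hu
  set u' : ℝ → ℝ := fun z => H (r + z) - H (r - z) with hu'
  have hud : ∀ z, HasDerivAt u (u' z) z := by
    intro z
    have d1 := hasDerivAt_increment hf r 1 z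
    have d2 := hasDerivAt_increment hf r (-1) z
    convert! d1.add d2 using 1
    · ext y; simp only [hu, Pi.add_apply, one_mul, neg_one_mul, ← sub_eq_add_neg]; ring
    · simp only [hu', one_mul, neg_one_mul, ← sub_eq_add_neg]
  obtain ⟨K₁, hK₁0, hK₁⟩ := exists_abs_increment_le hψ hH r 1
  obtain ⟨K₂, hK₂0, hK₂⟩ := exists_abs_increment_le hψ hH r (-1)
  have hsmall : ∀ z, 0 < z → z ≤ 1 → |u z| ≤ (K₁ + K₂) * z ^ (2 : ℝ) := by
    intro z hz0 hz1
    have hb : ∀ t ∈ Icc 0 z, ‖u' t‖ ≤ (K₁ + K₂) * z := by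
      intro t ht
      rcases eq_or_lt_of_le ht.1 with rfl | ht0
      · simp only [hu', add_zero, sub_zero, sub_self, norm_zero]; positivity
      · have a1 := hK₁ t ht0 (ht.2.trans hz1)
        have a2 := hK₂ t ht0 (ht.2.trans hz1)
        rw [Real.rpow_one] at a1 a2
        rw [one_mul] at a1
        rw [neg_one_mul, ← sub_eq_add_neg] at a2
        have : u' t = (H (r + t) - H r) - (H (r - t) - H r) := by simp only [hu']; ring
        rw [this, Real.norm_eq_abs]
        refine (abs_sub _ _).trans ((add_le_add a1 a2).trans ?_)
        rw [← add_mul]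
        exact mul_le_mul_of_nonneg_left ht.2 (by positivity)
    have := (convex_Icc (0 : ℝ) z).norm_image_sub_le_of_norm_hasDerivWithin_le
      (fun t _ => (hud t).hasDerivWithinAt) hb (left_mem_Icc.2 hz0.le) (right_mem_Icc.2 hz0.le)
    have hu0 : u 0 = 0 := by simp only [hu, add_zero, sub_zero]; ring
    rw [hu0, sub_zero, sub_zero, Real.norm_eq_abs, Real.norm_of_nonneg hz0.le] at this
    rw [Real.rpow_two]
    linarith
  have hlarge : ∀ z, 1 ≤ z → |u z| ≤ 4 * (C' * (2 + r) ^ q') * z ^ q' := by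
    intro z hz
    have a1 := abs_increment_le_of_growth (σ := 1) hr (by simp) hC' hq0' hfb hz
    have a2 := abs_increment_le_of_growth (σ := -1) hr (by simp) hC' hq0' hfb hz
    rw [one_mul] at a1
    rw [neg_one_mul, ← sub_eq_add_neg] at a2
    have : u z = (f (r + z) - f r) + (f (r - z) - f r) := by simp only [hu]; ring
    rw [this]
    refine (abs_add_le _ _).trans ((add_le_add a1 a2).trans (le_of_eq ?_))
    ring
  have huc : Continuous u := continuous_iff_continuousAt.2 fun z => (hud z).continuousAt
  have hI := integrableOn_div_rpow huc hq' (by linarith : 1 + γ < 2) hsmall hlarge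
  have I1 := integrableOn_increment (σ := 1) h1 hψ hH hr (by simp) hC hq0 hq hHb
  have I2 := integrableOn_increment (σ := -1) h1 hψ hH hr (by simp) hC hq0 hq hHb
  have hpt : ∀ z ∈ Ioi (0 : ℝ), (H (r + 1 * z) - H r) / z ^ (1 + γ)
      - (H (r + -1 * z) - H r) / z ^ (1 + γ) = u' z * z ^ (-(1 + γ)) := by
    intro z hz
    have hz : 0 < z := hz
    rw [Real.rpow_neg hz.le, ← sub_div, div_eq_mul_inv, one_mul, neg_one_mul, ← sub_eq_add_neg]
    congr 1; simp only [hu']; ring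
  have hI' : IntegrableOn (fun z => u' z * z ^ (-(1 + γ))) (Ioi 0) :=
    (integrableOn_congr_fun hpt measurableSet_Ioi).1 (I1.sub I2)
  have hlim := tendsto_integral_deriv_mul_rpow_neg hud hq' (by linarith : 1 + γ < 2) hsmall hlarge
    fun T hT => (intervalIntegrable_iff_integrableOn_Ioc_of_le hT.le).2
      (hI'.mono_set Ioc_subset_Ioi_self)
  have hlim' := intervalIntegral_tendsto_integral_Ioi 0 hI' tendsto_id
  refine ⟨hI, ?_⟩
  rw [← integral_sub I1 I2, setIntegral_congr_fun measurableSet_Ioi hpt]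
  exact tendsto_nhds_unique hlim hlim'

/-! ### Parity, growth at infinity and conclusion. -/

lemma rieszIntegrand_neg {f : ℝ → ℝ} (hf : ∀ x, f (-x) = f x) (β x z : ℝ) :
    rieszIntegrand β f (-x) z = rieszIntegrand β f x z := by
  rw [rieszIntegrand, rieszIntegrand, hf, show -x + z = -(x - z) by ring,
    show -x - z = -(x + z) by ring, hf, hf]
  congr 1; ring

lemma iteratedDeriv_neg_of_even {φ : ℝ → ℝ} (heven : ∀ x, φ (-x) = φ x) (j : ℕ) (x : ℝ) :
    iteratedDeriv j φ (-x) = (-1) ^ j * iteratedDeriv j φ x := by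
  have h := iteratedDeriv_comp_neg j φ (-x)
  rwa [funext heven, neg_neg, smul_eq_mul] at h

lemma hasDerivAt_iteratedDeriv {φ : ℝ → ℝ} {m j : ℕ} (hφ : ContDiff ℝ m φ) (hj : j < m) (y : ℝ) :
    HasDerivAt (iteratedDeriv j φ) (iteratedDeriv (j + 1) φ y) y := by
  rw [iteratedDeriv_succ]
  exact (hφ.differentiable_iteratedDeriv j (by exact_mod_cast hj) y).hasDerivAt

lemma exists_growth_bound {f : ℝ → ℝ} (hf : Continuous f) (hpar : ∀ y, |f (-y)| = |f y|)
    {s : ℂ} (hs : 0 < s.re) {δ : ℝ} {w : ℂ} (hw : w.re = s.re - δ) (hδ : 0 < δ)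
    (hlim : Tendsto (fun r : ℝ => (f r : ℂ) * (r : ℂ) ^ w) atTop (𝓝 0)) :
    ∃ C q, 0 ≤ C ∧ 0 ≤ q ∧ q < δ ∧ ∀ y, |f y| ≤ C * (1 + |y|) ^ q := by
  have hev : ∀ᶠ r : ℝ in atTop, ‖(f r : ℂ) * (r : ℂ) ^ w‖ < 1 := by
    simpa using hlim.norm.eventually (gt_mem_nhds (by simp))
  obtain ⟨R₀, hR₀⟩ := (hev.and (eventually_ge_atTop 1)).exists_forall_of_atTop
  obtain ⟨M, hM⟩ := isCompact_Icc.exists_bound_of_continuousOn (s := Icc 0 R₀) hf.continuousOn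
  -- The limit gives |f(y)| ≤ y^(δ - Re s) for large y; Re s > 0 makes this exponent smaller than δ,
  -- and the maximum with 0 keeps the bound monotone.
  set q := max 0 (δ - s.re) with hq
  have hR₀0 : 1 ≤ R₀ := (hR₀ R₀ le_rfl).2
  have hM0 : 0 ≤ M := (norm_nonneg _).trans (hM 0 ⟨le_rfl, by linarith⟩)
  have key : ∀ y, 0 ≤ y → |f y| ≤ (M + 1) * (1 + y) ^ q := by
    intro y hy
    have h1 : (1 : ℝ) ≤ (1 + y) ^ q := Real.one_le_rpow (by linarith) (le_max_left _ _)
    rcases le_or_gt y R₀ with h | h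
    · have h2 : |f y| ≤ M := hM y ⟨hy, h⟩
      nlinarith
    · obtain ⟨h3, h4⟩ := hR₀ y h.le
      have hy0 : 0 < y := by linarith
      rw [norm_mul, Complex.norm_real, Complex.norm_cpow_eq_rpow_re_of_pos hy0, hw,
        Real.norm_eq_abs] at h3
      have h5 : |f y| ≤ y ^ (δ - s.re) := by
        rw [show δ - s.re = -(s.re - δ) by ring, Real.rpow_neg hy0.le, ← one_div,
          le_div_iff₀ (Real.rpow_pos_of_pos hy0 _)]
        exact h3.le
      have h6 : y ^ (δ - s.re) ≤ (1 + y) ^ q :=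
        (Real.rpow_le_rpow_of_exponent_le h4 (le_max_right _ _)).trans
          (Real.rpow_le_rpow hy0.le (by linarith) (le_max_left _ _))
      nlinarith
  refine ⟨M + 1, q, by linarith, le_max_left _ _, max_lt hδ (by linarith), fun y => ?_⟩
  rcases le_total 0 y with h | h
  · rw [abs_of_nonneg h]; exact key y h
  · rw [abs_of_nonpos h, ← hpar]; exact key (-y) (by linarith)

lemma rieszConverges_and_hasKernelConvolution_of_pos {m : ℕ} {α : ℝ} (hα₁ : (m : ℝ) < α) (hα₂ : α < m + 1)
    {φ : ℝ → ℝ} (heven : ∀ x, φ (-x) = φ x) (hφ : ContDiff ℝ (m + 1 : ℕ) φ)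
    {s : ℂ} (hs : 0 < s.re)
    (hinfty : ∀ j : ℕ, j < m + 1 →
      Tendsto (fun r : ℝ => ((iteratedDeriv j φ r : ℝ) : ℂ) * (r : ℂ) ^ (s - (α : ℂ) + (j : ℂ)))
        atTop (𝓝 0)) {r : ℝ} (hr : 0 < r) :
    RieszConverges α φ r ∧
      HasKernelConvolution α (caputoDeriv (m + 1) α φ) r (rieszDeriv α φ r) := by
  obtain ⟨γ, rfl⟩ : ∃ γ, α = γ + m := ⟨α - m, by ring⟩
  have h0 : 0 < γ := by linarith
  have h1 : γ < 1 := by linarith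
  have hcont : ∀ j ≤ m + 1, Continuous (iteratedDeriv j φ) := fun j hj =>
    hφ.continuous_iteratedDeriv j (by exact_mod_cast hj)
  have hgrow : ∀ j ≤ m, ∃ C q, 0 ≤ C ∧ 0 ≤ q ∧ q < γ + m - j ∧
      ∀ y, |iteratedDeriv j φ y| ≤ C * (1 + |y|) ^ q := by
    intro j hj
    have hj' : (j : ℝ) ≤ m := by exact_mod_cast hj
    refine exists_growth_bound (hcont j (by lia)) (fun y => ?_) hs ?_ (by linarith)
      (hinfty j (by lia))
    · rw [iteratedDeriv_neg_of_even heven, abs_mul, abs_pow, abs_neg, abs_one, one_pow, one_mul]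
    · simp; ring
  have hψ := hcont (m + 1) le_rfl
  have hH := hasDerivAt_iteratedDeriv hφ (Nat.lt_succ_self m)
  obtain ⟨C, q, hC, hq0, hq, hHb⟩ := hgrow m le_rfl
  rw [add_sub_cancel_right] at hq
  have hcap : caputoDeriv (m + 1) (γ + m) φ = rlIntegral (1 - γ) (iteratedDeriv (m + 1) φ) := by
    ext t
    rw [caputoDeriv]
    congr 1; push_cast; ring
  have hconv := hasKernelConvolution_rlIntegral m h0 h1 hψ hH hr hC hq0 hq hHb fun y => by
    rw [iteratedDeriv_neg_of_even heven, pow_succ]; ring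
  rw [hcap]
  -- Here m is the integer part of α, so ⌊α/2⌋ = k in both cases. The Riesz integral has order γ and
  -- acts on H itself if m = 2k; it has order 1 + γ and acts on the antiderivative φ^(2k) of H if m
  -- = 2k + 1.
  rcases Nat.even_or_odd' m with ⟨k, hk | hk⟩
  · have hmk : (m : ℝ) = 2 * k := by rw [hk]; push_cast; ring
    have hfl : ⌊(γ + m) / 2⌋₊ = k := by
      rw [Nat.floor_eq_iff (by positivity), hmk]; constructor <;> linarith
    have hβ : γ + m - 2 * ((k : ℕ) : ℝ) = γ := by rw [hmk]; ring
    obtain ⟨hI, hv⟩ := riesz_increment_sum h1 hψ hH hr hC hq0 hq hHb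
    rw [RieszConverges, rieszDeriv, rieszDerivBase, hfl, hβ, ← hk]
    refine ⟨hI, ?_⟩
    convert hconv using 1
    have hs' : Real.sin (Real.pi * (γ + m) / 2) = (-1) ^ k * Real.sin (Real.pi * γ / 2) := by
      rw [show Real.pi * (γ + m) / 2 = Real.pi * γ / 2 + k * Real.pi by rw [hmk]; ring,
        Real.sin_add_nat_mul_pi]
    have hm1 : (-1 : ℝ) ^ m = 1 := by rw [hk, pow_mul]; simp
    rw [hv, hs', hm1, one_mul]
    ring
  · have hmk : (m : ℝ) = 2 * k + 1 := by rw [hk]; push_cast; ring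
    have hfl : ⌊(γ + m) / 2⌋₊ = k := by
      rw [Nat.floor_eq_iff (by positivity), hmk]; constructor <;> linarith
    have hβ : γ + m - 2 * ((k : ℕ) : ℝ) = 1 + γ := by rw [hmk]; ring
    obtain ⟨C', q', hC', hq0', hq', hfb⟩ := hgrow (2 * k) (by lia)
    have hq'' : q' < 1 + γ := by push_cast at hq'; linarith
    have hf : ∀ y, HasDerivAt (iteratedDeriv (2 * k) φ) (iteratedDeriv m φ y) y := by
      rw [hk]; exact hasDerivAt_iteratedDeriv hφ (by lia)
    obtain ⟨hI, hv⟩ := riesz_increment_sub h1 hψ hf hH hr hC hq0 hq hHb hC' hq0' hq'' hfb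
    rw [RieszConverges, rieszDeriv, rieszDerivBase, hfl, hβ]
    refine ⟨hI, ?_⟩
    convert hconv using 1
    have hs' : Real.sin (Real.pi * (γ + m) / 2)
        = (-1) ^ k * Real.sin (Real.pi * (1 + γ) / 2) := by
      rw [show Real.pi * (γ + m) / 2 = Real.pi * (1 + γ) / 2 + k * Real.pi by rw [hmk]; ring,
        Real.sin_add_nat_mul_pi]
    have hm1 : (-1 : ℝ) ^ m = -1 := by rw [hk, pow_succ, pow_mul]; simp
    rw [hs', hm1, neg_one_mul, ← sub_eq_add_neg, ← hv, add_comm 1 (1 + γ),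
      Real.Gamma_add_one (by positivity : 1 + γ ≠ 0)]
    ring

theorem mainTheorem3 (m : ℕ) (hm : 1 ≤ m) (α : ℝ) (hα₁ : (m : ℝ) - 1 < α) (hα₂ : α < m)
    (φ : ℝ → ℝ) (heven : ∀ x, φ (-x) = φ x) (hφ : ContDiff ℝ m φ)
    (s : ℂ) (hs : 0 < s.re)
    (hzero : ∀ j : ℕ, j < m →
      Tendsto (fun r : ℝ => ((iteratedDeriv j φ r : ℝ) : ℂ) * (r : ℂ) ^ (s - (α : ℂ) + (j : ℂ)))
        (𝓝[>] (0 : ℝ)) (𝓝 0))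
    (hinfty : ∀ j : ℕ, j < m →
      Tendsto (fun r : ℝ => ((iteratedDeriv j φ r : ℝ) : ℂ) * (r : ℂ) ^ (s - (α : ℂ) + (j : ℂ)))
        atTop (𝓝 0)) :
    (∀ t : ℝ, 0 < t → IntervalIntegrable
        (fun τ => (t - τ) ^ ((m : ℝ) - α - 1) * iteratedDeriv m φ τ) volume 0 t) ∧
    ∀ x : ℝ, x ≠ 0 →
      RieszConverges α φ x ∧
      HasKernelConvolution α (caputoDeriv m α φ) |x| (rieszDeriv α φ x) := by
  refine ⟨fun t _ => ?_, fun x hx => ?_⟩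
  · have h := (intervalIntegral.intervalIntegrable_rpow' (a := t) (b := 0)
      (r := (m : ℝ) - α - 1) (by linarith)).comp_sub_left t
    rw [sub_self, sub_zero] at h
    exact h.mul_continuousOn (hφ.continuous_iteratedDeriv m le_rfl).continuousOn
  · obtain ⟨n, rfl⟩ : ∃ n, m = n + 1 := ⟨m - 1, by lia⟩
    push_cast at hα₁ hα₂
    have key := rieszConverges_and_hasKernelConvolution_of_pos (by linarith) hα₂ heven hφ hs hinfty (abs_pos.2 hx)
    rcases abs_choice x with h | h
    · rwa [h] at key ⊢
    · have hfun : rieszIntegrand (α - 2 * (⌊α / 2⌋₊ : ℝ)) (iteratedDeriv (2 * ⌊α / 2⌋₊) φ) |x|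
          = rieszIntegrand (α - 2 * (⌊α / 2⌋₊ : ℝ)) (iteratedDeriv (2 * ⌊α / 2⌋₊) φ) x := by
        ext z
        rw [h]
        refine rieszIntegrand_neg (fun y => ?_) _ x z
        rw [iteratedDeriv_neg_of_even heven, pow_mul]
        simp
      rwa [RieszConverges, rieszDeriv, rieszDerivBase, hfun] at key
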